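/- Let $d\ge 1$, let $E$ be a nonempty finite set, let $P$ be a stochastic matrix on $E$, let $\mathcal V=\{\pm e_1,\dots,\pm e_d\}$ be the set of signed canonical basis vectors of $\mathbb R^d$, and for each $x\in\mathbb R^d$, $i\in E$ let $(p(x,i,v))_{v\in\mathcal V}$ be a probability vector. Assume - (A.1) there is a finite $K$ with $|p(x,i,v)-p(y,i,v)|\le K|x-y|$ for all $x,y\in\mathbb R^d$, $i\in E$, $v\in\mathcal V$; - (A.2) $p(x,i,v)>0$ for all $x\in\mathbb R^d$, $i\in E$, $v\in\mathcal V$; - (A.3) $P$ is irreducible. Let $(\xi_k)_{k\ge 0}$ be the Markov chain with transition matrix $P$ and $\xi_0=i$ under $\mathbb P^i$ (expectation $\mathbb E^i$) and, for frozen $x$, given $(\xi_k)$, let $f(x,\xi_k,U_k)$, $k\ge1$, be independent $\mathcal V$-valued steps with laws $p(x,\xi_k,\cdot)$. Put $$H(x,\alpha)=\lim_{n\to\infty}\frac1n\ln\mathbb E^i\exp\Big\langle\alpha,\sum_{k=1}^n f(x,\xi_k,U_k)\Big\rangle,\qquad L(x,v)=\sup_{\alpha\in\mathbb R^d}\{\langle\alpha,v\rangle-H(x,\alpha)\}.$$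 For $x\in\partial[0,1]^d$ let $\mathcal N(x)$ be the set of unit outward normals at $x$: the unit vectors $v$ with $v_\ell=0$ if $0<x_\ell<1$, $v_\ell\le0$ if $x_\ell=0$, $v_\ell\ge0$ if $x_\ell=1$. For a continuous $w:[0,T]\to\mathbb R^d$ with $w_0\in[0,1]^d$, write $x=\Psi(w)$ if $x:[0,T]\to[0,1]^d$ is continuous and $k=w-x$ has bounded variation $|k|$ and satisfies $k_t=\int_0^t n_s\,d|k|_s$ with $n_s\in\mathcal N(x_s)$ and $|k|_t=\int_0^t\mathbf 1_{\{x_s\in\partial[0,1]^d\}}d|k|_s$ (Skorohod problem). Define $$J^y_{0,T}(\phi)=\inf\Big\{\int_0^T L(\phi_s,\dot\psi_s)\,ds:\ \psi\text{ absolutely continuous},\ \Psi(\psi)=\phi\Big\}$$ if $\phi_0=y$ and such a $\psi$ exists, and $J^y_{0,T}(\phi)=\infty$ otherwise, and let $V$ be the quasi-potential from the origin, $$V(x)=\inf\{J^0_{0,T}(\phi):\ T>0,\ \phi_0=0,\ \phi_T=x\},\qquad x\in[0,1]^d.$$ The limit defining $H$ exists for all $x,\alpha\in\mathbb R^d$ and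 does not depend on $i$, and $V$ is finite on $[0,1]^d$. If moreover $V$ is continuously differentiable on $[0,1]^d\setminus\{0\}$ (up to the boundary), then $$H(x,\nabla V(x))=0\quad\text{for all }x\in(0,1)^d,$$ $$H(x,\nabla_+V(x))=0\quad\text{for all }x\in\partial[0,1]^d\setminus\{0\},$$ where, for such boundary points, $(\nabla_+V(x))_i$ is $\partial_{x_i}V(x)$ if $0<x_i<1$, $\min(\partial_{x_i}V(x),0)$ if $x_i=0$, and $\max(\partial_{x_i}V(x),0)$ if $x_i=1$. -/

import Mathlib

open Set Filter Topology MeasureTheory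
open scoped ENNReal RealInnerProductSpace

namespace ReflectedWalk

/-- The Euclidean space `ℝ^d`. -/
abbrev Space (d : ℕ) : Type := EuclideanSpace ℝ (Fin d)

/-- The closed hypercube `[0,1]^d`. Its topological boundary is `frontier (cube d)`. -/
def cube (d : ℕ) : Set (Space d) := {x | ∀ l, x l ∈ Icc (0 : ℝ) 1}

/-- The open hypercube `(0,1)^d`. -/
def openCube (d : ℕ) : Set (Space d) := {x | ∀ l, x l ∈ Ioo (0 : ℝ) 1}

/-- The index set of the steps `±e_1, …, ±e_d` of the walk: a coordinate and a sign. -/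
abbrev Step (d : ℕ) : Type := Fin d × ℤˣ

/-- The step vector `± e_l`. -/
noncomputable def Step.vec {d : ℕ} (v : Step d) : Space d :=
  EuclideanSpace.single v.1 ((v.2 : ℤ) : ℝ)

/-- `p x i v` is the probability of the step `v` at position `x` in the environment `i`. -/
structure IsStepLaw {d : ℕ} {E : Type*} (p : Space d → E → Step d → ℝ) : Prop where
  nonneg : ∀ x i v, 0 ≤ p x i v
  sum_eq_one : ∀ x i, ∑ v, p x i v = 1

/-- Smoothness: the step probabilities are Lipschitz in the position. -/
def SmoothLaw {d : ℕ} {E : Type*} (p : Space d → E → Step d → ℝ) : Prop :=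
  ∃ K : ℝ, ∀ x y i v, |p x i v - p y i v| ≤ K * ‖x - y‖

/-- Ellipticity: all the step probabilities are positive. -/
def EllipticLaw {d : ℕ} {E : Type*} (p : Space d → E → Step d → ℝ) : Prop :=
  ∀ x i v, 0 < p x i v

section Model

variable {d : ℕ} {E : Type*} [Fintype E]

/-- `𝔼^i exp ⟨α, ∑_{k=1}^n f(x, ξ_k, U_k)⟩`, written out with the joint law of the environments
`ξ_1, …, ξ_n` (the Markov chain with transition matrix `P` and `ξ_0 = i`) and of the steps
`f(x, ξ_k, U_k)`: given the environments, the steps are independent with laws `p x (ξ_k)`, the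
position variable being frozen at `x`. -/
noncomputable def expMoment (P : Matrix E E ℝ) (p : Space d → E → Step d → ℝ)
    (i : E) (n : ℕ) (x α : Space d) : ℝ :=
  ∑ ξ : Fin n → E, ∑ v : Fin n → Step d,
    (∏ k : Fin n, P ((Fin.cons i ξ : Fin (n + 1) → E) k.castSucc) (ξ k) * p x (ξ k) (v k)) *
      Real.exp ⟪α, ∑ k, (v k).vec⟫

/-- `n⁻¹ ln 𝔼^i exp ⟨α, ∑_{k=1}^n f(x, ξ_k, U_k)⟩`. -/
noncomputable def scaledCumulant (P : Matrix E E ℝ) (p : Space d → E → Step d → ℝ)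
    (i : E) (x α : Space d) (n : ℕ) : ℝ :=
  (n : ℝ)⁻¹ * Real.log (expMoment P p i n x α)

/-- The Hamiltonian `H(x, α) = lim_n n⁻¹ ln 𝔼^i exp ⟨α, ∑_{k=1}^n f(x, ξ_k, U_k)⟩`, computed from
the starting environment `i`. -/
noncomputable def hamiltonian (P : Matrix E E ℝ) (p : Space d → E → Step d → ℝ)
    (i : E) (x α : Space d) : ℝ :=
  limUnder atTop (scaledCumulant P p i x α)

/-- The Lagrangian `L(x, v) = sup_α (⟨α, v⟩ - H(x, α))`, with values in `[-∞, ∞]`. -/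
noncomputable def lagrangian (P : Matrix E E ℝ) (p : Space d → E → Step d → ℝ)
    (i : E) (x v : Space d) : EReal :=
  ⨆ α : Space d, ((⟪α, v⟫ - hamiltonian P p i x α : ℝ) : EReal)

end Model

/-- The unit outward normals to the hypercube at `x` (an empty set if `x` is in `(0,1)^d`). -/
def normals {d : ℕ} (x : Space d) : Set (Space d) :=
  {v | ‖v‖ = 1 ∧ ∀ l, (x l ∈ Ioo (0 : ℝ) 1 → v l = 0) ∧ (x l = 0 → v l ≤ 0) ∧ (x l = 1 → 0 ≤ v l)}

/-- `x = Ψ(w)` on `[0,T]`: the continuous path `x` in the hypercube is the solution of the Skorohod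
problem driven by the continuous path `w`. The pushing process is `k = w - x`; the measure `μ` is
`d|k|`, i.e. its mass on `(0,t]` is the total variation `|k|_t` of `k` on `[0,t]`. The conditions are
`k_t = ∫_0^t n_s d|k|_s` with `n_s ∈ 𝒩(x_s)`, and `d|k|` is carried by the times at which `x` is on
the boundary of the hypercube. -/
def IsReflection {d : ℕ} (T : ℝ) (w x : ℝ → Space d) : Prop :=
  ContinuousOn w (Icc 0 T) ∧ ContinuousOn x (Icc 0 T) ∧ (∀ t ∈ Icc 0 T, x t ∈ cube d) ∧
  ∃ (μ : Measure ℝ) (n : ℝ → Space d), IsFiniteMeasure μ ∧ Measurable n ∧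
    (∀ t ∈ Icc 0 T, eVariationOn (fun s => w s - x s) (Icc 0 t) = μ (Ioc 0 t)) ∧
    (∀ᵐ s ∂μ.restrict (Ioc 0 T), x s ∈ frontier (cube d) ∧ n s ∈ normals (x s)) ∧
    (∀ t ∈ Icc 0 T, w t - x t = ∫ s in Ioc 0 t, n s ∂μ)

section Potential

variable {d : ℕ} {E : Type*} [Fintype E]

/-- The action functional `J_{0,T}^y(φ)`: the infimum of `∫_0^T L(φ_s, ψ'_s) ds` over the absolutely
continuous paths `ψ` with `Ψ(ψ) = φ`, if `φ_0 = y` and such paths exist, and `∞` otherwise. The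
Lagrangian is nonnegative, because `H(x, 0) = 0`. -/
noncomputable def action (P : Matrix E E ℝ) (p : Space d → E → Step d → ℝ) (i : E)
    (T : ℝ) (y : Space d) (φ : ℝ → Space d) : ℝ≥0∞ :=
  ⨅ (ψ : ℝ → Space d)
    (_ : φ 0 = y ∧ AbsolutelyContinuousOnInterval ψ 0 T ∧ IsReflection T ψ φ),
    ∫⁻ s in Ioc 0 T, (lagrangian P p i (φ s) (deriv ψ s)).toENNReal

/-- The quasi-potential `V(x, y) = inf {J_{0,T}^x(φ); φ_0 = x, φ_T = y, T > 0}`. -/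
noncomputable def quasiPotential (P : Matrix E E ℝ) (p : Space d → E → Step d → ℝ) (i : E)
    (x y : Space d) : ℝ≥0∞ :=
  ⨅ (T : ℝ) (φ : ℝ → Space d) (_ : 0 < T ∧ φ 0 = x ∧ φ T = y), action P p i T x φ

/-- The function `V(x) = V(0, x)`, as a real number. -/
noncomputable def potential (P : Matrix E E ℝ) (p : Space d → E → Step d → ℝ) (i : E)
    (x : Space d) : ℝ :=
  (quasiPotential P p i 0 x).toReal

end Potential

/-- The modified gradient `∇₊V(x)` at a point `x ≠ 0` of the boundary of the hypercube. The gradient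
at `x` is the one relative to `[0,1]^d \ {0}`. -/
noncomputable def gradPlus {d : ℕ} (V : Space d → ℝ) (x : Space d) : Space d :=
  WithLp.toLp 2 fun l =>
    if x l = 0 then min (gradientWithin V (cube d \ {0}) x l) 0
    else if x l = 1 then max (gradientWithin V (cube d \ {0}) x l) 0
    else gradientWithin V (cube d \ {0}) x l

end ReflectedWalk

namespace ReflectedWalk

/-! ### Exponential moments of the walk: the Markov recursion -/

section Moments

variable {d : ℕ} {E : Type*} [Fintype E] {P : Matrix E E ℝ} {p : Space d → E → Step d → ℝ}

/-! Existence of `H` is Fekete's lemma: the moments summed over initial environments are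
submultiplicative, and irreducibility makes each single moment comparable to that sum. The moment
formula makes `H(x, ·)` convex and 1-Lipschitz; ellipticity and compactness make `H(·, α)` Lipschitz
on the cube uniformly in `α`, and `L` bounded on velocities of `ℓ¹`-norm at most one. Straight
segments then show that `V` is finite.

Fix `x ≠ 0` in the cube and write `g = ∇V(x)`, `β = ∇₊V(x)`.

Upper bound (`hamiltonian_gradPlus_nonpos`). If `H(x, β) > 0`, convexity gives an affine minorant
`⟨·, v⟩ + c` of `H(x, ·)` that is positive at `β`, so `L(x, v) ≤ -c < ⟨β, v⟩`. Cancelling suitable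
outward coordinates of `v` gives a reflected velocity `u` with `⟨β, v⟩ ≤ ⟨g, u⟩`. Prolonging paths
at driving velocity `v` for a short time moves them at velocity `u` and costs at most about `-c` per
unit time, so `⟨g, u⟩ ≤ -c`, a contradiction.

Lower bound (`hamiltonian_gradPlus_nonneg`). If `H(x, β) < 0`, there is room to tilt `β` by a small
vector towards `x` and keep `H ≤ 0` in a small ball around `x`. The tilted `γ` satisfies `L ≥ ⟨γ,
·⟩` there and points outwards on the faces met, so reflection cannot lower the cost of crossing the
ball below `⟨γ, displacement⟩`. Added to the first-order expansion of `V` at the entrance point,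
this makes every path to `x` cost more than `V(x)` by a fixed amount.

In the open cube `∇₊V = ∇V`, so both equations are the same statement. -/

lemma expMoment_zero (i : E) (x α : Space d) : expMoment P p i 0 x α = 1 := by
  simp [expMoment]

/-- Markov property at time one: the first environment and the first step are split off with
`Fin.cons`, and what remains is a walk started from `j`. -/
lemma expMoment_succ (i : E) (n : ℕ) (x α : Space d) :
    expMoment P p i (n + 1) x α =
      ∑ j, P i j * (∑ v, p x j v * Real.exp ⟪α, v.vec⟫) * expMoment P p j n x α := by
  have hE : ∀ F : (Fin (n + 1) → E) → ℝ, ∑ ξ, F ξ = ∑ j, ∑ ξ : Fin n → E, F (Fin.cons j ξ) :=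
    fun F => by
      rw [← (Fin.consEquiv fun _ => E).sum_comp, Fintype.sum_prod_type]
      rfl
  have hS : ∀ F : (Fin (n + 1) → Step d) → ℝ,
      ∑ v, F v = ∑ v₀, ∑ v : Fin n → Step d, F (Fin.cons v₀ v) := fun F => by
    rw [← (Fin.consEquiv fun _ => Step d).sum_comp, Fintype.sum_prod_type]
    rfl
  unfold expMoment
  rw [hE]
  refine Finset.sum_congr rfl fun j _ => ?_
  rw [Finset.mul_sum]
  refine Finset.sum_congr rfl fun ξ _ => ?_
  rw [hS, Finset.mul_sum (s := (Finset.univ : Finset (Step d))), Finset.sum_mul_sum]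
  refine Finset.sum_congr rfl fun v₀ _ => Finset.sum_congr rfl fun v _ => ?_
  rw [Fin.prod_univ_succ, Fin.sum_univ_succ, inner_add_right, Real.exp_add]
  simp only [Fin.cons_zero, Fin.cons_succ, Fin.castSucc_zero, ← Fin.succ_castSucc]
  ring

end Moments

/-- Convexity of the logarithm of a finite sum of exponentials. -/
lemma log_sum_exp_convex {ι : Type*} (s : Finset ι) (w f g : ι → ℝ) (hw : ∀ k ∈ s, 0 ≤ w k)
    (hf : 0 < ∑ k ∈ s, w k * Real.exp (f k)) (hg : 0 < ∑ k ∈ s, w k * Real.exp (g k))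
    {a b : ℝ} (ha : 0 ≤ a) (hb : 0 ≤ b) (hab : a + b = 1) :
    ∑ k ∈ s, w k * Real.exp (a * f k + b * g k) ≤
      Real.exp (a * Real.log (∑ k ∈ s, w k * Real.exp (f k)) +
        b * Real.log (∑ k ∈ s, w k * Real.exp (g k))) := by
  set A := ∑ k ∈ s, w k * Real.exp (f k)
  set B := ∑ k ∈ s, w k * Real.exp (g k)
  have key : ∀ k ∈ s, w k * Real.exp (a * f k + b * g k) ≤
      Real.exp (a * Real.log A + b * Real.log B) *
        (a * (w k * Real.exp (f k)) / A + b * (w k * Real.exp (g k)) / B) := by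
    intro k hk
    -- Normalising by `A` and `B` makes the two exponential sums equal to one, so the pointwise
    -- convexity bounds add up to `a + b = 1`.
    have h := convexOn_exp.2 (mem_univ (f k - Real.log A)) (mem_univ (g k - Real.log B)) ha hb hab
    simp only [smul_eq_mul, Real.exp_sub, Real.exp_log hf, Real.exp_log hg] at h
    have e : a * f k + b * g k = (a * Real.log A + b * Real.log B) +
        (a * (f k - Real.log A) + b * (g k - Real.log B)) := by ring
    rw [e, Real.exp_add]
    calc w k * (Real.exp (a * Real.log A + b * Real.log B) *
          Real.exp (a * (f k - Real.log A) + b * (g k - Real.log B)))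
        ≤ w k * (Real.exp (a * Real.log A + b * Real.log B) *
          (a * (Real.exp (f k) / A) + b * (Real.exp (g k) / B))) := by
          gcongr; exact hw k hk
      _ = _ := by ring
  refine (Finset.sum_le_sum key).trans_eq ?_
  rw [← Finset.mul_sum, Finset.sum_add_distrib, ← Finset.sum_div, ← Finset.sum_div,
    ← Finset.mul_sum, ← Finset.mul_sum, mul_div_assoc, mul_div_assoc, div_self hf.ne',
    div_self hg.ne']
  simp [hab]

/-! ### The Hamiltonian: existence, convexity and regularity in `α` -/

section Hamiltonian

variable {d : ℕ} {E : Type*} {p : Space d → E → Step d → ℝ}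

/-- The exponential moment of one step in the environment `j`. -/
noncomputable def stepMoment (p : Space d → E → Step d → ℝ) (j : E) (x α : Space d) : ℝ :=
  ∑ v, p x j v * Real.exp ⟪α, v.vec⟫

lemma Step.norm_vec (v : Step d) : ‖v.vec‖ = 1 := by
  rcases Int.units_eq_one_or v.2 with h | h <;> simp [Step.vec, h]

lemma Step.abs_inner_vec_le (v : Step d) (α : Space d) : |⟪α, v.vec⟫| ≤ ‖α‖ := by
  simpa [v.norm_vec] using abs_real_inner_le_norm α v.vec

lemma stepMoment_ge (hp : IsStepLaw p) (j : E) (x α : Space d) (v : Step d) :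
    p x j v * Real.exp ⟪α, v.vec⟫ ≤ stepMoment p j x α :=
  Finset.single_le_sum (f := fun v : Step d => p x j v * Real.exp ⟪α, v.vec⟫)
    (fun v _ => mul_nonneg (hp.nonneg x j v) (Real.exp_pos _).le) (Finset.mem_univ v)

lemma stepMoment_ge_exp (hp : IsStepLaw p) (j : E) (x α : Space d) :
    Real.exp (-‖α‖) ≤ stepMoment p j x α := by
  calc Real.exp (-‖α‖) = ∑ v, p x j v * Real.exp (-‖α‖) := by
        rw [← Finset.sum_mul, hp.sum_eq_one, one_mul]
    _ ≤ _ := Finset.sum_le_sum fun v _ => by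
        have := (abs_le.1 (v.abs_inner_vec_le α)).1
        gcongr
        exact hp.nonneg x j v

lemma stepMoment_pos (hp : IsStepLaw p) (j : E) (x α : Space d) : 0 < stepMoment p j x α :=
  (Real.exp_pos _).trans_le (stepMoment_ge_exp hp j x α)

variable [Fintype E] [DecidableEq E] {P : Matrix E E ℝ}

/-- A lower bound for the exponential moments of the steps bounds those of the walk. -/
lemma pow_le_expMoment (hP : P ∈ Matrix.rowStochastic ℝ E) {x α : Space d} {c : ℝ} (hc : 0 ≤ c)
    (h : ∀ j, c ≤ stepMoment p j x α) (i : E) (n : ℕ) : c ^ n ≤ expMoment P p i n x α := by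
  induction n generalizing i with
  | zero => simp [expMoment_zero]
  | succ n ih =>
    rw [expMoment_succ]
    calc c ^ (n + 1) = ∑ j, P i j * c * c ^ n := by
          rw [← Finset.sum_mul, ← Finset.sum_mul, Matrix.sum_row_of_mem_rowStochastic hP, one_mul,
            pow_succ']
      _ ≤ _ := Finset.sum_le_sum fun j _ => by
          have hPij := Matrix.nonneg_of_mem_rowStochastic hP (i := i) (j := j)
          have hj := h j
          have := ih j
          unfold stepMoment at hj
          gcongr
          exact mul_nonneg hPij (hc.trans hj)

lemma expMoment_pos (hP : P ∈ Matrix.rowStochastic ℝ E) (hp : IsStepLaw p) (i : E) (n : ℕ)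
    (x α : Space d) : 0 < expMoment P p i n x α :=
  (pow_pos (Real.exp_pos (-‖α‖)) n).trans_le
    (pow_le_expMoment hP (Real.exp_pos _).le (fun j => stepMoment_ge_exp hp j x α) i n)

lemma expMoment_zero_right (hP : P ∈ Matrix.rowStochastic ℝ E) (hp : IsStepLaw p) (i : E) (n : ℕ)
    (x : Space d) : expMoment P p i n x 0 = 1 := by
  induction n generalizing i with
  | zero => exact expMoment_zero ..
  | succ n ih =>
    simp [expMoment_succ, ih, hp.sum_eq_one, Matrix.sum_row_of_mem_rowStochastic hP]

/-- The sum over the initial environments of the exponential moments. -/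
noncomputable def totalMoment (P : Matrix E E ℝ) (p : Space d → E → Step d → ℝ) (n : ℕ)
    (x α : Space d) : ℝ :=
  ∑ j, expMoment P p j n x α

lemma expMoment_le_totalMoment (hP : P ∈ Matrix.rowStochastic ℝ E) (hp : IsStepLaw p) (i : E)
    (n : ℕ) (x α : Space d) : expMoment P p i n x α ≤ totalMoment P p n x α :=
  Finset.single_le_sum (f := fun j => expMoment P p j n x α)
    (fun j _ => (expMoment_pos hP hp j n x α).le) (Finset.mem_univ i)

/-- After `m` steps the walk restarts from some environment, whose moment is at most the sum over
all environments. -/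
lemma expMoment_add_le (hP : P ∈ Matrix.rowStochastic ℝ E) (hp : IsStepLaw p) (i : E) (m n : ℕ)
    (x α : Space d) :
    expMoment P p i (m + n) x α ≤ expMoment P p i m x α * totalMoment P p n x α := by
  induction m generalizing i with
  | zero => simpa [expMoment_zero] using expMoment_le_totalMoment hP hp i n x α
  | succ m ih =>
    rw [Nat.succ_add, expMoment_succ, expMoment_succ, Finset.sum_mul]
    refine Finset.sum_le_sum fun j _ => ?_
    rw [mul_assoc _ (expMoment P p j m x α)]
    exact mul_le_mul_of_nonneg_left (ih j) (mul_nonneg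
      (Matrix.nonneg_of_mem_rowStochastic hP) (stepMoment_pos hp j x α).le)

lemma totalMoment_add_le (hP : P ∈ Matrix.rowStochastic ℝ E) (hp : IsStepLaw p) (m n : ℕ)
    (x α : Space d) :
    totalMoment P p (m + n) x α ≤ totalMoment P p m x α * totalMoment P p n x α := by
  rw [totalMoment, totalMoment, Finset.sum_mul]
  exact Finset.sum_le_sum fun j _ => expMoment_add_le hP hp j m n x α

/-- The exponential moments from two initial environments are comparable. -/
lemma exists_expMoment_le (hP : P ∈ Matrix.rowStochastic ℝ E) (hp : IsStepLaw p)
    (hirr : P.IsIrreducible) (x α : Space d) (i j : E) :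
    ∃ c : ℝ, ∀ n, expMoment P p j n x α ≤ c * expMoment P p i n x α := by
  let := Matrix.toQuiver P
  obtain ⟨q, -⟩ := hirr.connected i j
  suffices ∃ c : ℝ, 0 ≤ c ∧ ∀ n, expMoment P p j n x α ≤ c * expMoment P p i n x α from
    this.imp fun _ h => h.2
  -- Induction along a path of positive transitions from `i` to `j`. Across an edge from `k` to `l`,
  -- the moment from `l` over `n` steps is controlled by the one from `k` over `n + 1` steps, whose
  -- extra step costs at most the factor `totalMoment P p 1`.
  induction q with
  | nil => exact ⟨1, zero_le_one, fun n => (one_mul _).ge⟩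
  | @cons k l _ e ih =>
    obtain ⟨c, hc, h⟩ := ih
    have hkl : 0 < P k l * stepMoment p l x α := mul_pos e.down (stepMoment_pos hp l x α)
    have hT : 0 ≤ totalMoment P p 1 x α := (expMoment_pos hP hp i 1 x α).le.trans
      (expMoment_le_totalMoment hP hp i 1 x α)
    refine ⟨(P k l * stepMoment p l x α)⁻¹ * totalMoment P p 1 x α * c, by positivity, fun n => ?_⟩
    have h1 : P k l * stepMoment p l x α * expMoment P p l n x α ≤
        expMoment P p k (n + 1) x α := by
      rw [expMoment_succ]
      exact Finset.single_le_sum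
        (f := fun j => P k j * stepMoment p j x α * expMoment P p j n x α)
        (fun j _ => mul_nonneg (mul_nonneg (Matrix.nonneg_of_mem_rowStochastic hP)
          (stepMoment_pos hp j x α).le) (expMoment_pos hP hp j n x α).le) (Finset.mem_univ l)
    calc expMoment P p l n x α
        = (P k l * stepMoment p l x α)⁻¹ *
            (P k l * stepMoment p l x α * expMoment P p l n x α) := by
          rw [inv_mul_cancel_left₀ hkl.ne']
      _ ≤ (P k l * stepMoment p l x α)⁻¹ *
            (expMoment P p k n x α * totalMoment P p 1 x α) := by
          exact mul_le_mul_of_nonneg_left (h1.trans (expMoment_add_le hP hp k n 1 x α))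
            (inv_nonneg.2 hkl.le)
      _ ≤ (P k l * stepMoment p l x α)⁻¹ *
            (c * expMoment P p i n x α * totalMoment P p 1 x α) := by
          gcongr
          exact h n
      _ = _ := by ring

/-- Fekete's lemma for the logarithm of the total moment; each single moment agrees with the total
one up to a factor independent of `n`, which disappears after division by `n`. -/
lemma exists_tendsto_scaledCumulant (hP : P ∈ Matrix.rowStochastic ℝ E) (hp : IsStepLaw p)
    (hirr : P.IsIrreducible) (x α : Space d) :
    ∃ h : ℝ, ∀ i, Tendsto (scaledCumulant P p i x α) atTop (𝓝 h) := by
  rcases isEmpty_or_nonempty E with hE | ⟨⟨i₀⟩⟩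
  · exact ⟨0, fun i => isEmptyElim i⟩
  have hpos : ∀ n, 0 < totalMoment P p n x α := fun n =>
    (expMoment_pos hP hp i₀ n x α).trans_le (expMoment_le_totalMoment hP hp i₀ n x α)
  have hsub : Subadditive fun n => Real.log (totalMoment P p n x α) := fun m n => by
    rw [← Real.log_mul (hpos m).ne' (hpos n).ne']
    exact Real.log_le_log (hpos _) (totalMoment_add_le hP hp m n x α)
  have hbdd : BddBelow (range fun n : ℕ => Real.log (totalMoment P p n x α) / n) := by
    refine ⟨-‖α‖, ?_⟩
    rintro _ ⟨n, rfl⟩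
    rcases Nat.eq_zero_or_pos n with rfl | hn
    · simp
    have hn' : (0 : ℝ) < n := by exact_mod_cast hn
    rw [le_div_iff₀ hn', ← Real.log_exp (-‖α‖ * n)]
    refine Real.log_le_log (Real.exp_pos _) ?_
    rw [mul_comm, Real.exp_nat_mul]
    exact (pow_le_expMoment hP (Real.exp_pos _).le (fun j => stepMoment_ge_exp hp j x α) i₀ n).trans
      (expMoment_le_totalMoment hP hp i₀ n x α)
  refine ⟨hsub.lim, fun i => ?_⟩
  have hT := hsub.tendsto_lim hbdd
  choose c hc using exists_expMoment_le hP hp hirr x α i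
  have hle : ∀ n, totalMoment P p n x α ≤ (∑ j, c j) * expMoment P p i n x α := fun n => by
    rw [Finset.sum_mul]
    exact Finset.sum_le_sum fun j _ => hc j n
  -- Read off at `n = 0`, where the single moment is one.
  have hC : 0 < ∑ j, c j := by
    have := (hpos 0).trans_le (hle 0)
    rwa [expMoment_zero, mul_one] at this
  have hL : Tendsto (fun n : ℕ => Real.log (totalMoment P p n x α) / n -
      Real.log (∑ j, c j) / n) atTop (𝓝 hsub.lim) := by
    simpa using hT.sub (tendsto_const_div_atTop_nhds_zero_nat (Real.log (∑ j, c j)))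
  refine tendsto_of_tendsto_of_tendsto_of_le_of_le hL hT (fun n => ?_) (fun n => ?_)
  · simp only [scaledCumulant]
    rw [← sub_div, div_eq_inv_mul]
    have := Real.log_le_log (hpos n) (hle n)
    rw [Real.log_mul hC.ne' (expMoment_pos hP hp i n x α).ne'] at this
    gcongr
    linarith
  · simp only [scaledCumulant, div_eq_inv_mul]
    gcongr
    · exact expMoment_pos hP hp i n x α
    · exact expMoment_le_totalMoment hP hp i n x α

/-- The limit defining the Hamiltonian exists, and it does not depend on the initial environment. -/
lemma tendsto_scaledCumulant (hP : P ∈ Matrix.rowStochastic ℝ E) (hp : IsStepLaw p)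
    (hirr : P.IsIrreducible) (i j : E) (x α : Space d) :
    Tendsto (scaledCumulant P p j x α) atTop (𝓝 (hamiltonian P p i x α)) := by
  obtain ⟨h, hh⟩ := exists_tendsto_scaledCumulant hP hp hirr x α
  rw [hamiltonian, (hh i).limUnder_eq]
  exact hh j

lemma hamiltonian_zero (hP : P ∈ Matrix.rowStochastic ℝ E) (hp : IsStepLaw p)
    (hirr : P.IsIrreducible) (i : E) (x : Space d) : hamiltonian P p i x 0 = 0 := by
  refine tendsto_nhds_unique (tendsto_scaledCumulant hP hp hirr i i x 0) ?_
  have : scaledCumulant P p i x 0 = fun _ => 0 := by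
    ext n
    simp [scaledCumulant, expMoment_zero_right hP hp]
  rw [this]
  exact tendsto_const_nhds

/-- Comparison of two values of the Hamiltonian. -/
lemma hamiltonian_le_add (hP : P ∈ Matrix.rowStochastic ℝ E) (hp : IsStepLaw p)
    (hirr : P.IsIrreducible) (i : E) {x y α β : Space d} {c : ℝ}
    (h : ∀ n : ℕ, expMoment P p i n x α ≤ Real.exp (n * c) * expMoment P p i n y β) :
    hamiltonian P p i x α ≤ hamiltonian P p i y β + c := by
  refine le_of_tendsto_of_tendsto (tendsto_scaledCumulant hP hp hirr i i x α)
    ((tendsto_scaledCumulant hP hp hirr i i y β).add_const c) ?_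
  filter_upwards [eventually_gt_atTop 0] with n hn
  have hn' : (0 : ℝ) < n := by exact_mod_cast hn
  have := Real.log_le_log (expMoment_pos hP hp i n x α) (h n)
  rw [Real.log_mul (Real.exp_pos _).ne' (expMoment_pos hP hp i n y β).ne', Real.log_exp] at this
  calc scaledCumulant P p i x α n ≤ (n : ℝ)⁻¹ * (n * c + Real.log (expMoment P p i n y β)) := by
        unfold scaledCumulant; gcongr
    _ = _ := by unfold scaledCumulant; field_simp; ring

/-- Steps have norm one, so replacing `β` by `α` raises the exponent by at most `n * ‖α - β‖`. -/
lemma hamiltonian_lipschitz (hP : P ∈ Matrix.rowStochastic ℝ E) (hp : IsStepLaw p)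
    (hirr : P.IsIrreducible) (i : E) (x α β : Space d) :
    hamiltonian P p i x α ≤ hamiltonian P p i x β + ‖α - β‖ := by
  refine hamiltonian_le_add hP hp hirr i fun n => ?_
  simp only [expMoment, Finset.mul_sum]
  refine Finset.sum_le_sum fun ξ _ => Finset.sum_le_sum fun v _ => ?_
  have hw : 0 ≤ ∏ k : Fin n, P ((Fin.cons i ξ : Fin (n + 1) → E) k.castSucc) (ξ k) *
      p x (ξ k) (v k) := Finset.prod_nonneg fun k _ =>
    mul_nonneg (Matrix.nonneg_of_mem_rowStochastic hP) (hp.nonneg ..)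
  rw [mul_left_comm, ← Real.exp_add]
  gcongr
  have h1 : ⟪α - β, ∑ k, (v k).vec⟫ ≤ n * ‖α - β‖ := by
    rw [inner_sum]
    calc ∑ k, ⟪α - β, (v k).vec⟫ ≤ ∑ _k : Fin n, ‖α - β‖ :=
          Finset.sum_le_sum fun k _ => (le_abs_self _).trans ((v k).abs_inner_vec_le _)
      _ = _ := by simp
  rw [inner_sub_left] at h1
  linarith

lemma continuous_hamiltonian (hP : P ∈ Matrix.rowStochastic ℝ E) (hp : IsStepLaw p)
    (hirr : P.IsIrreducible) (i : E) (x : Space d) : Continuous (hamiltonian P p i x) :=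
  (LipschitzWith.of_le_add fun α β => by
    rw [dist_eq_norm]; exact hamiltonian_lipschitz hP hp hirr i x α β).continuous

/-- Each scaled cumulant is convex in `α`, being a log-sum-exp over all trajectories, and convexity
passes to the limit. -/
lemma convexOn_hamiltonian (hP : P ∈ Matrix.rowStochastic ℝ E) (hp : IsStepLaw p)
    (hirr : P.IsIrreducible) (i : E) (x : Space d) :
    ConvexOn ℝ univ (hamiltonian P p i x) := by
  refine ⟨convex_univ, fun α _ β _ a b ha hb hab => ?_⟩
  refine le_of_tendsto_of_tendsto' (tendsto_scaledCumulant hP hp hirr i i x _)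
    (((tendsto_scaledCumulant hP hp hirr i i x α).const_mul a).add
      ((tendsto_scaledCumulant hP hp hirr i i x β).const_mul b)) fun n => ?_
  have key := log_sum_exp_convex (Finset.univ : Finset ((Fin n → E) × (Fin n → Step d)))
    (fun z => ∏ k : Fin n, P ((Fin.cons i z.1 : Fin (n + 1) → E) k.castSucc) (z.1 k) *
      p x (z.1 k) (z.2 k))
    (fun z => ⟪α, ∑ k, (z.2 k).vec⟫) (fun z => ⟪β, ∑ k, (z.2 k).vec⟫)
    (fun z _ => Finset.prod_nonneg fun k _ =>
      mul_nonneg (Matrix.nonneg_of_mem_rowStochastic hP) (hp.nonneg ..))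
    (by rw [Fintype.sum_prod_type]; exact expMoment_pos hP hp i n x α)
    (by rw [Fintype.sum_prod_type]; exact expMoment_pos hP hp i n x β) ha hb hab
  simp only [Fintype.sum_prod_type] at key
  have e : ∀ s : Space d, a * ⟪α, s⟫ + b * ⟪β, s⟫ = ⟪a • α + b • β, s⟫ := fun s => by
    rw [inner_add_left, real_inner_smul_left, real_inner_smul_left]
  simp only [e] at key
  have key2 := (Real.log_le_iff_le_exp (expMoment_pos hP hp i n x (a • α + b • β))).2 key
  calc scaledCumulant P p i x (a • α + b • β) n
      ≤ (n : ℝ)⁻¹ * (a * Real.log (expMoment P p i n x α) +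
          b * Real.log (expMoment P p i n x β)) := by
        unfold scaledCumulant
        gcongr
        exact key2
    _ = _ := by simp only [scaledCumulant]; ring

/-- Keep only the trajectories that always make the step `v`. -/
lemma log_add_inner_le_hamiltonian (hP : P ∈ Matrix.rowStochastic ℝ E) (hp : IsStepLaw p)
    (hirr : P.IsIrreducible) (i : E) {x : Space d} {c : ℝ} (hc : 0 < c) {v : Step d}
    (h : ∀ j, c ≤ p x j v) (α : Space d) :
    Real.log c + ⟪α, v.vec⟫ ≤ hamiltonian P p i x α := by
  refine ge_of_tendsto (tendsto_scaledCumulant hP hp hirr i i x α) ?_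
  filter_upwards [eventually_gt_atTop 0] with n hn
  have hn' : (0 : ℝ) < n := by exact_mod_cast hn
  have hpos : 0 < c * Real.exp ⟪α, v.vec⟫ := by positivity
  have := Real.log_le_log (pow_pos hpos n) (pow_le_expMoment hP hpos.le (x := x) (α := α)
    (fun j => (mul_le_mul_of_nonneg_right (h j) (Real.exp_pos _).le).trans
      (stepMoment_ge hp j x α v)) i n)
  rw [Real.log_pow, Real.log_mul hc.ne' (Real.exp_pos _).ne', Real.log_exp] at this
  rw [scaledCumulant, inv_mul_eq_div, le_div_iff₀ hn']
  linarith

end Hamiltonian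

/-! ### Uniform estimates on the cube -/

section Cube

variable {d : ℕ} {E : Type*} [Fintype E] {P : Matrix E E ℝ} {p : Space d → E → Step d → ℝ}

lemma isClosed_cube : IsClosed (cube d) := by
  simp only [cube, ofPred_forall]
  exact isClosed_iInter fun l => isClosed_Icc.preimage (by fun_prop)

lemma isCompact_cube : IsCompact (cube d) := by
  refine Metric.isCompact_of_isClosed_isBounded isClosed_cube ?_
  refine (Metric.isBounded_closedBall (x := (0 : Space d)) (r := √d)).subset fun x hx => ?_
  rw [mem_closedBall_zero_iff, EuclideanSpace.norm_eq]
  refine Real.sqrt_le_sqrt ?_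
  calc ∑ l, ‖x l‖ ^ 2 ≤ ∑ _l : Fin d, (1 : ℝ) := Finset.sum_le_sum fun l _ => by
        have := hx l
        rw [Real.norm_eq_abs, sq_abs]
        nlinarith [this.1, this.2]
    _ = d := by simp

lemma zero_mem_cube : (0 : Space d) ∈ cube d := fun l => by simp

lemma exists_pos_le_stepLaw (hSmooth : SmoothLaw p) (hElliptic : EllipticLaw p) :
    ∃ c : ℝ, 0 < c ∧ ∀ x ∈ cube d, ∀ j v, c ≤ p x j v := by
  obtain ⟨K, hK⟩ := hSmooth
  have h1 : ∀ z : E × Step d, ∃ c : ℝ, 0 < c ∧ ∀ x ∈ cube d, c ≤ p x z.1 z.2 := by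
    rintro ⟨j, v⟩
    have hcont : Continuous fun x => p x j v := by
      refine (LipschitzWith.of_dist_le_mul (K := K.toNNReal) fun x y => ?_).continuous
      rw [Real.dist_eq, dist_eq_norm]
      exact (hK x y j v).trans (mul_le_mul_of_nonneg_right (Real.le_coe_toNNReal K) (norm_nonneg _))
    obtain ⟨x, -, hx⟩ := isCompact_cube.exists_isMinOn ⟨0, zero_mem_cube⟩ hcont.continuousOn
    exact ⟨p x j v, hElliptic x j v, fun y hy => hx hy⟩
  choose c hc h using h1
  have : ∃ m : ℝ, 0 < m ∧ ∀ z, m ≤ c z := by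
    rcases isEmpty_or_nonempty (E × Step d) with hE | hE
    · exact ⟨1, one_pos, fun z => isEmptyElim z⟩
    · obtain ⟨z, hz⟩ := Finite.exists_min c
      exact ⟨c z, hc z, hz⟩
  obtain ⟨m, hm, hmc⟩ := this
  exact ⟨m, hm, fun x hx j v => (hmc (j, v)).trans (h (j, v) x hx)⟩

variable [DecidableEq E]

/-- With `p ≥ c` on the cube, the ratio of step laws at `x` and `y` is at most `1 + |K| ‖x - y‖ /
c`, hence at most the exponential of `|K| ‖x - y‖ / c`. This factor is free of `α`, and so is the
Lipschitz constant. -/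
lemma exists_hamiltonian_lipschitz_left (hP : P ∈ Matrix.rowStochastic ℝ E) (hp : IsStepLaw p)
    (hSmooth : SmoothLaw p) (hElliptic : EllipticLaw p) (hirr : P.IsIrreducible) (i : E) :
    ∃ C : ℝ, 0 ≤ C ∧ ∀ x ∈ cube d, ∀ y ∈ cube d, ∀ α,
      hamiltonian P p i x α ≤ hamiltonian P p i y α + C * ‖x - y‖ := by
  obtain ⟨c, hc, hpc⟩ := exists_pos_le_stepLaw hSmooth hElliptic
  obtain ⟨K, hK⟩ := hSmooth
  refine ⟨|K| / c, by positivity, fun x hx y hy α => hamiltonian_le_add hP hp hirr i fun n => ?_⟩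
  have hstep : ∀ j v, p x j v ≤ Real.exp (|K| / c * ‖x - y‖) * p y j v := fun j v => by
    have h1 := (abs_le.1 (hK x y j v)).2
    have h2 : K * ‖x - y‖ ≤ |K| * ‖x - y‖ := by gcongr; exact le_abs_self K
    have h3 : |K| * ‖x - y‖ ≤ |K| / c * ‖x - y‖ * p y j v := by
      calc |K| * ‖x - y‖ = |K| / c * ‖x - y‖ * c := by field_simp
        _ ≤ _ := by gcongr; exact hpc y hy j v
    have h4 := mul_le_mul_of_nonneg_right (Real.add_one_le_exp (|K| / c * ‖x - y‖))
      (hp.nonneg y j v)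
    linarith
  simp only [expMoment, Finset.mul_sum]
  refine Finset.sum_le_sum fun ξ _ => Finset.sum_le_sum fun v _ => ?_
  rw [← mul_assoc]
  refine mul_le_mul_of_nonneg_right ?_ (Real.exp_pos _).le
  calc _ ≤ ∏ k : Fin n, Real.exp (|K| / c * ‖x - y‖) *
        (P ((Fin.cons i ξ : Fin (n + 1) → E) k.castSucc) (ξ k) * p y (ξ k) (v k)) := by
        refine Finset.prod_le_prod (fun k _ => mul_nonneg
          (Matrix.nonneg_of_mem_rowStochastic hP) (hp.nonneg ..)) fun k _ => ?_
        rw [mul_left_comm]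
        exact mul_le_mul_of_nonneg_left (hstep _ _) (Matrix.nonneg_of_mem_rowStochastic hP)
    _ = _ := by
        rw [Finset.prod_mul_distrib, Finset.prod_const, Finset.card_univ, Fintype.card_fin,
          ← Real.exp_nat_mul]

/-- The Lagrangian is bounded on the velocities of `ℓ¹`-norm at most one. -/
lemma exists_lagrangian_le (hP : P ∈ Matrix.rowStochastic ℝ E) (hp : IsStepLaw p)
    (hSmooth : SmoothLaw p) (hElliptic : EllipticLaw p) (hirr : P.IsIrreducible) (i : E) :
    ∃ C : ℝ, ∀ x ∈ cube d, ∀ u : Space d, ∑ l, |u l| ≤ 1 →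
      lagrangian P p i x u ≤ (C : EReal) := by
  obtain ⟨c, hc, hpc⟩ := exists_pos_le_stepLaw hSmooth hElliptic
  refine ⟨-Real.log c, fun x hx u hu => iSup_le fun α => ?_⟩
  rw [EReal.coe_le_coe_iff]
  have hd : Nonempty (Step d) := by
    by_contra h
    rw [not_nonempty_iff] at h
    simpa using hp.sum_eq_one x i
  obtain ⟨⟨l₀, -⟩⟩ := hd
  -- Duality of `ℓ¹` and `ℓ^∞`: `⟪α, u⟫ ≤ max |α l|`, and one of the steps `± e_m` attains this
  -- maximum, so `H` grows at least as fast as `⟪α, u⟫` up to `log c`.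
  obtain ⟨m, -, hm⟩ := Finset.exists_max_image Finset.univ (fun l => |α l|) ⟨l₀, Finset.mem_univ _⟩
  have h1 : ⟪α, u⟫ ≤ |α m| := by
    rw [PiLp.inner_apply]
    calc ∑ l, ⟪α l, u l⟫ ≤ ∑ l, |α m| * |u l| := Finset.sum_le_sum fun l _ => by
          refine (le_abs_self _).trans ?_
          simp only [RCLike.inner_apply, conj_trivial, abs_mul]
          rw [mul_comm]
          exact mul_le_mul_of_nonneg_right (hm l (Finset.mem_univ _)) (abs_nonneg _)
      _ = |α m| * ∑ l, |u l| := (Finset.mul_sum ..).symm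
      _ ≤ |α m| * 1 := by gcongr
      _ = _ := mul_one _
  have h2 : ∃ v : Step d, ⟪α, v.vec⟫ = |α m| := by
    rcases abs_cases (α m) with ⟨h, -⟩ | ⟨h, -⟩
    · exact ⟨(m, 1), by simp [Step.vec, h, EuclideanSpace.inner_single_right]⟩
    · exact ⟨(m, -1), by simp [Step.vec, h, EuclideanSpace.inner_single_right]⟩
  obtain ⟨v, hv⟩ := h2
  have h3 := log_add_inner_le_hamiltonian hP hp hirr i hc (v := v) (fun j => hpc x hx j v) α
  linarith

end Cube

/-! ### Prolonging a reflected path at constant velocity -/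

section Extension

/-- Stopping a function at time `b` preserves absolute continuity. -/
lemma absolutelyContinuousOnInterval_comp_min {X : Type*} [PseudoMetricSpace X] {f : ℝ → X}
    {a b c : ℝ} (hab : a ≤ b) (hbc : b ≤ c) (hf : AbsolutelyContinuousOnInterval f a b) :
    AbsolutelyContinuousOnInterval (fun s => f (min s b)) a c := by
  rw [absolutelyContinuousOnInterval_iff] at hf ⊢
  intro ε hε
  obtain ⟨δ, hδ, h⟩ := hf ε hε
  refine ⟨δ, hδ, fun I hI hlen => ?_⟩
  refine h (I.1, fun k => (min (I.2 k).1 b, min (I.2 k).2 b)) ⟨fun k hk => ?_, ?_⟩ ?_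
  · have := hI.1 k hk
    simp only [uIcc_of_le hab, uIcc_of_le (hab.trans hbc), mem_Icc] at this ⊢
    grind
  · refine hI.2.mono fun k => ?_
    intro z hz
    simp only [uIoc, mem_Ioc] at hz ⊢
    grind
  · refine (Finset.sum_le_sum fun k _ => ?_).trans_lt hlen
    simp only [Real.dist_eq]
    simpa using abs_min_sub_min_le_max (I.2 k).1 b (I.2 k).2 b

variable {d : ℕ}

/-- The path `f` up to time `T`, followed by the motion at the constant velocity `v`. -/
noncomputable def extend (f : ℝ → Space d) (T : ℝ) (v : Space d) (s : ℝ) : Space d :=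
  if s ≤ T then f s else f T + (s - T) • v

lemma extend_of_le {f : ℝ → Space d} {T s : ℝ} {v : Space d} (h : s ≤ T) :
    extend f T v s = f s := if_pos h

lemma extend_of_ge {f : ℝ → Space d} {T s : ℝ} {v : Space d} (h : T ≤ s) :
    extend f T v s = f T + (s - T) • v := by
  rcases h.eq_or_lt with rfl | h
  · simp [extend]
  · exact if_neg h.not_ge

lemma extend_eq (f : ℝ → Space d) (T : ℝ) (v : Space d) :
    extend f T v = (fun s => f (min s T)) + fun s => (max s T - T) • v := by
  ext1 s
  rcases le_total s T with h | h
  · simp [extend_of_le h, h]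
  · simp [extend_of_ge h, h]

lemma extend_sub_extend (f g : ℝ → Space d) (T : ℝ) (v u : Space d) :
    (fun s => extend f T v s - extend g T u s) = extend (fun s => f s - g s) T (v - u) := by
  ext1 s
  rcases le_total s T with h | h
  · simp only [extend_of_le h]
  · simp only [extend_of_ge h, smul_sub]
    abel

lemma deriv_extend_of_lt {f : ℝ → Space d} {T s : ℝ} {v : Space d} (h : s < T) :
    deriv (extend f T v) s = deriv f s := by
  refine EventuallyEq.deriv_eq ?_
  filter_upwards [Iio_mem_nhds h] with r hr
  exact extend_of_le (le_of_lt hr)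

lemma deriv_extend_of_gt {f : ℝ → Space d} {T s : ℝ} {v : Space d} (h : T < s) :
    deriv (extend f T v) s = v := by
  have h1 : extend f T v =ᶠ[𝓝 s] fun r => f T + (r - T) • v := by
    filter_upwards [Ioi_mem_nhds h] with r hr
    exact extend_of_ge (le_of_lt hr)
  rw [h1.deriv_eq]
  have h2 := (((hasDerivAt_id s).sub_const T).smul_const v).const_add (f T)
  simpa using h2.deriv

lemma absolutelyContinuousOnInterval_extend {f : ℝ → Space d} {T t : ℝ} (hT : 0 ≤ T) (ht : 0 ≤ t)
    (hf : AbsolutelyContinuousOnInterval f 0 T) (v : Space d) :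
    AbsolutelyContinuousOnInterval (extend f T v) 0 (T + t) := by
  rw [extend_eq]
  refine (absolutelyContinuousOnInterval_comp_min hT (by linarith) hf).add ?_
  refine LipschitzOnWith.absolutelyContinuousOnInterval (K := ‖v‖₊)
    (LipschitzOnWith.of_dist_le_mul fun r _ s _ => ?_)
  rw [dist_eq_norm, ← sub_smul, norm_smul, Real.norm_eq_abs, mul_comm, sub_sub_sub_cancel_right,
    coe_nnnorm, Real.dist_eq]
  exact mul_le_mul_of_nonneg_left (abs_max_sub_max_le_abs r s T) (norm_nonneg v)

lemma continuousOn_extend {f : ℝ → Space d} {T t : ℝ} (hT : 0 ≤ T)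
    (hf : ContinuousOn f (Icc 0 T)) (v : Space d) :
    ContinuousOn (extend f T v) (Icc 0 (T + t)) := by
  rw [extend_eq]
  refine ContinuousOn.add ?_ (by fun_prop)
  exact hf.comp (by fun_prop) fun s hs => ⟨le_min hs.1 hT, min_le_right _ _⟩

/-- The variation of a motion at constant velocity. -/
lemma eVariationOn_extend_Icc (f : ℝ → Space d) {T r : ℝ} (hr : T ≤ r) (w : Space d) :
    eVariationOn (extend f T w) (Icc T r) = ‖w‖ₑ * ENNReal.ofReal (r - T) := by
  have e : ∀ a ∈ Icc T r, ∀ b ∈ Icc T r,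
      edist (extend f T w a) (extend f T w b) = ‖w‖ₑ * edist a b := fun a ha b hb => by
    rw [extend_of_ge ha.1, extend_of_ge hb.1, edist_eq_enorm_sub, add_sub_add_left_eq_sub,
      ← sub_smul, enorm_smul, mul_comm, sub_sub_sub_cancel_right, edist_eq_enorm_sub]
  apply le_antisymm
  · have hl : LipschitzOnWith ‖w‖₊ (extend f T w) (Icc T r) := fun a ha b hb => (e a ha b hb).le
    calc eVariationOn (extend f T w) (Icc T r)
        ≤ ‖w‖ₑ * eVariationOn (id : ℝ → ℝ) (Icc T r) := hl.comp_eVariationOn_le (mapsTo_id _)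
      _ ≤ _ := by
        gcongr
        have := monotoneOn_id.eVariationOn_eq (s := Icc T r) (left_mem_Icc.2 hr)
          (right_mem_Icc.2 hr)
        rw [inter_self] at this
        exact this.le
  · have := eVariationOn.edist_le (extend f T w) (left_mem_Icc.2 hr) (right_mem_Icc.2 hr)
    rwa [e _ (left_mem_Icc.2 hr) _ (right_mem_Icc.2 hr), edist_comm, edist_dist, Real.dist_eq,
      abs_of_nonneg (sub_nonneg.2 hr)] at this

lemma coord_mem_Ioo_of_mem_interior_cube {x : Space d} (hx : x ∈ interior (cube d)) (l : Fin d) :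
    x l ∈ Ioo (0 : ℝ) 1 := by
  have hopen : IsOpenMap (fun x : Space d => x l) := by
    refine (EuclideanSpace.proj l : Space d →L[ℝ] ℝ).isOpenMap fun r => ?_
    exact ⟨EuclideanSpace.single l r, by simp⟩
  have h : (fun x : Space d => x l) '' interior (cube d) ⊆ interior (Icc 0 1) :=
    interior_maximal (by rintro _ ⟨y, hy, rfl⟩; exact interior_subset hy l)
      (hopen _ isOpen_interior)
  rw [interior_Icc] at h
  exact h (mem_image_of_mem _ hx)

lemma mem_frontier_cube {x : Space d} (hx : x ∈ cube d) {l : Fin d} (hl : x l = 0 ∨ x l = 1) :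
    x ∈ frontier (cube d) := by
  refine ⟨subset_closure hx, fun h => ?_⟩
  have := coord_mem_Ioo_of_mem_interior_cube h l
  rcases hl with hl | hl <;> simp [hl] at this

/-- The reflection of the velocity `v` along the boundary: `u` is obtained from `v` by cancelling
some coordinates that point outside of the cube at `y`. -/
def IsReflectedVelocity (y v u : Space d) : Prop :=
  ∀ l, u l = v l ∨ (y l = 0 ∧ v l ≤ 0 ∧ u l = 0) ∨ (y l = 1 ∧ 0 ≤ v l ∧ u l = 0)

/-- A cancelled coordinate is constant along the segment, which therefore stays on the corresponding
face; `v - u` lives on the cancelled coordinates and points outwards there. -/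
lemma IsReflectedVelocity.mem_frontier_and_normals {y v u : Space d}
    (h : IsReflectedVelocity y v u) (huv : v ≠ u) {s : ℝ} (hs : y + s • u ∈ cube d) :
    y + s • u ∈ frontier (cube d) ∧ ‖v - u‖⁻¹ • (v - u) ∈ normals (y + s • u) := by
  have hpos : 0 < ‖v - u‖ := norm_pos_iff.2 (sub_ne_zero.2 huv)
  refine ⟨?_, ?_, fun l => ?_⟩
  · obtain ⟨l, hl⟩ : ∃ l, u l ≠ v l := by
      by_contra! hc
      exact huv (PiLp.ext fun l => (hc l).symm)
    refine mem_frontier_cube hs (l := l) ?_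
    rcases h l with h | ⟨h1, -, h2⟩ | ⟨h1, -, h2⟩
    · exact absurd h hl
    · simp [h1, h2]
    · simp [h1, h2]
  · rw [norm_smul, norm_inv, norm_norm, inv_mul_cancel₀ hpos.ne']
  · simp only [PiLp.smul_apply, PiLp.add_apply, PiLp.sub_apply, smul_eq_mul]
    rcases h l with h | ⟨h1, h2, h3⟩ | ⟨h1, h2, h3⟩
    · simp [h]
    · simp only [h1, h3, mul_zero, add_zero, sub_zero, mem_Ioo, lt_irrefl, false_and,
        false_imp_iff, true_and, zero_ne_one]
      exact ⟨fun _ => mul_nonpos_of_nonneg_of_nonpos (inv_nonneg.2 hpos.le) h2, trivial⟩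
    · simp only [h1, h3, mul_zero, add_zero, sub_zero, mem_Ioo, lt_irrefl, and_false,
        false_imp_iff, true_and, one_ne_zero]
      exact fun _ => mul_nonneg (inv_nonneg.2 hpos.le) h2

lemma integrableOn_of_ae_mem_normals {μ : Measure ℝ} [IsFiniteMeasure μ] {n x : ℝ → Space d}
    {T : ℝ} (hn : Measurable n)
    (h : ∀ᵐ s ∂μ.restrict (Ioc 0 T), x s ∈ frontier (cube d) ∧ n s ∈ normals (x s)) :
    IntegrableOn n (Ioc 0 T) μ :=
  Integrable.of_bound hn.aestronglyMeasurable 1 (h.mono fun _ hs => hs.2.1.le)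

/-- After time `T` the pushing process moves at the constant velocity `w = v - u`: its variation
measure is `‖w‖` times Lebesgue measure and its direction is `w / ‖w‖`. -/
lemma IsReflection.extend {T t : ℝ} (hT : 0 ≤ T) {ψ φ : ℝ → Space d} (h : IsReflection T ψ φ)
    {v u : Space d} (hvu : IsReflectedVelocity (φ T) v u)
    (hcube : ∀ s ∈ Icc 0 t, φ T + s • u ∈ cube d) :
    IsReflection (T + t) (extend ψ T v) (extend φ T u) := by
  obtain ⟨hψ, hφ, hφc, μ, n, hμ, hn, hvar, hae, hint⟩ := h
  have hcube' : ∀ s ∈ Ioc T (T + t), φ T + (s - T) • u ∈ cube d := fun s hs =>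
    hcube _ ⟨by linarith [hs.1], by linarith [hs.2]⟩
  refine ⟨continuousOn_extend hT hψ v, continuousOn_extend hT hφ u, fun s hs => ?_, ?_⟩
  · rcases le_or_gt s T with h | h
    · rw [extend_of_le h]
      exact hφc s ⟨hs.1, h⟩
    · rw [extend_of_ge h.le]
      exact hcube' s ⟨h, hs.2⟩
  rw [extend_sub_extend]
  set w := v - u with hw
  set n' : ℝ → Space d := fun s => if s ≤ T then n s else ‖w‖⁻¹ • w with hn'
  set ν : Measure ℝ := μ.restrict (Ioc 0 T) + ‖w‖ₑ • volume.restrict (Ioc T (T + t)) with hν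
  have hν1 : ∀ r, r ≤ T → ν.restrict (Ioc 0 r) = μ.restrict (Ioc 0 r) := fun r hr => by
    rw [hν, Measure.restrict_add, Measure.restrict_smul, Measure.restrict_restrict measurableSet_Ioc,
      Measure.restrict_restrict measurableSet_Ioc, inter_eq_left.2 (Ioc_subset_Ioc_right hr),
      (disjoint_left.2 fun s hs hs' => absurd (hs.2.trans hr) hs'.1.not_ge :
        Disjoint (Ioc 0 r) (Ioc T (T + t))).inter_eq]
    simp
  have hν2 : ∀ r, T ≤ r → r ≤ T + t → ν.restrict (Ioc 0 r) =
      μ.restrict (Ioc 0 T) + ‖w‖ₑ • volume.restrict (Ioc T r) := fun r hr hr' => by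
    have e : Ioc 0 r ∩ Ioc T (T + t) = Ioc T r := by
      rw [Ioc_inter_Ioc]
      congr 1
      · exact max_eq_right hT
      · exact min_eq_left hr'
    rw [hν, Measure.restrict_add, Measure.restrict_smul, Measure.restrict_restrict measurableSet_Ioc,
      Measure.restrict_restrict measurableSet_Ioc, inter_eq_right.2 (Ioc_subset_Ioc_right hr), e]
  have hn1 : EqOn n' n (Ioc 0 T) := fun s hs => if_pos hs.2
  have hn2 : ∀ r, EqOn n' (fun _ => ‖w‖⁻¹ • w) (Ioc T r) := fun r s hs => if_neg hs.1.not_ge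
  refine ⟨ν, n', ?_, hn.ite measurableSet_Iic measurable_const, fun r hr => ?_, ?_, fun r hr => ?_⟩
  · have : IsFiniteMeasure (‖w‖ₑ • volume.restrict (Ioc T (T + t))) :=
      Measure.smul_finite _ enorm_ne_top
    infer_instance
  · rw [← Measure.restrict_apply_self ν]
    rcases le_total r T with h | h
    · rw [hν1 r h, Measure.restrict_apply_self, ← hvar r ⟨hr.1, h⟩]
      exact eVariationOn.congr fun s hs => extend_of_le (hs.2.trans h)
    · have h1 := eVariationOn.Icc_add_Icc (ReflectedWalk.extend (fun s => ψ s - φ s) T w)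
        (s := univ) hT h (mem_univ _)
      simp only [univ_inter] at h1
      rw [← h1, eVariationOn_extend_Icc _ h, hν2 r h hr.2, Measure.add_apply, Measure.smul_apply,
        Measure.restrict_apply measurableSet_Ioc, Measure.restrict_apply measurableSet_Ioc,
        inter_eq_right.2 (Ioc_subset_Ioc_right h), inter_eq_right.2 (Ioc_subset_Ioc_left hT),
        Real.volume_Ioc, smul_eq_mul, ← hvar T ⟨hT, le_rfl⟩]
      congr 1
      exact eVariationOn.congr fun s hs => extend_of_le hs.2
  -- For negative `t` the time interval ends before `T`, and only the old measure is seen.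
  · rcases lt_or_ge t 0 with ht | ht
    · rw [hν1 _ (by linarith)]
      filter_upwards [ae_restrict_of_ae_restrict_of_subset
        (Ioc_subset_Ioc_right (by linarith)) hae, ae_restrict_mem measurableSet_Ioc] with s hs hs'
      have : s ≤ T := by linarith [hs'.2]
      rwa [extend_of_le this, hn1 ⟨hs'.1, this⟩]
    rw [hν2 _ (by linarith) le_rfl, ae_add_measure_iff]
    constructor
    · filter_upwards [hae, ae_restrict_mem measurableSet_Ioc] with s hs hs'
      rwa [extend_of_le hs'.2, hn1 hs']
    · by_cases hvu' : v = u
      · simp [hw, hvu']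
      · refine Measure.ae_smul_measure ?_ _
        filter_upwards [ae_restrict_mem measurableSet_Ioc] with s hs
        rw [extend_of_ge hs.1.le, hn2 _ hs]
        exact hvu.mem_frontier_and_normals hvu' (hcube' s hs)
  · have hr0 : IntegrableOn n' (Ioc 0 T) μ :=
      (integrableOn_of_ae_mem_normals hn hae).congr_fun hn1.symm measurableSet_Ioc
    change (fun s => ReflectedWalk.extend ψ T v s - ReflectedWalk.extend φ T u s) r = _
    rw [extend_sub_extend, ← hw]
    rcases le_total r T with h | h
    · rw [hν1 r h, extend_of_le h, hint r ⟨hr.1, h⟩]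
      exact (setIntegral_congr_fun measurableSet_Ioc (hn1.mono (Ioc_subset_Ioc_right h))).symm
    · have hi : Integrable n' (‖w‖ₑ • volume.restrict (Ioc T r)) := by
        refine Integrable.smul_measure ?_ enorm_ne_top
        exact (integrableOn_const (by simp) (by simp)).congr_fun (hn2 r).symm measurableSet_Ioc
      rw [hν2 r h hr.2, extend_of_ge h, integral_add_measure hr0 hi, integral_smul_measure,
        setIntegral_congr_fun measurableSet_Ioc hn1, setIntegral_congr_fun measurableSet_Ioc (hn2 r),
        hint T ⟨hT, le_rfl⟩]
      congr 1
      simp only [toReal_enorm, setIntegral_const, measureReal_def, Real.volume_Ioc,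
        ENNReal.toReal_ofReal (sub_nonneg.2 h)]
      rcases eq_or_ne w 0 with h0 | h0
      · simp [h0]
      · rw [smul_smul, smul_smul]
        congr 1
        have := norm_ne_zero_iff.2 h0
        field_simp

end Extension

/-! ### Dynamic programming and finiteness of the quasi-potential -/

section Potential

variable {d : ℕ} {E : Type*} [Fintype E] {P : Matrix E E ℝ} {p : Space d → E → Step d → ℝ}

lemma quasiPotential_le {i : E} {x y : Space d} {T : ℝ} {φ ψ : ℝ → Space d} (hT : 0 < T)
    (h0 : φ 0 = x) (h1 : φ T = y) (hac : AbsolutelyContinuousOnInterval ψ 0 T)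
    (hψ : IsReflection T ψ φ) :
    quasiPotential P p i x y ≤
      ∫⁻ s in Ioc 0 T, (lagrangian P p i (φ s) (deriv ψ s)).toENNReal :=
  iInf_le_of_le T <| iInf_le_of_le φ <| iInf_le_of_le ⟨hT, h0, h1⟩ <|
    iInf_le_of_le ψ <| iInf_le_of_le ⟨h0, hac, hψ⟩ le_rfl

/-- Extending a path by a reflected motion at constant velocity bounds the quasi-potential. -/
lemma quasiPotential_add_le {i : E} {y v u : Space d} {t B : ℝ} (ht : 0 ≤ t)
    (hvu : IsReflectedVelocity y v u) (hcube : ∀ s ∈ Icc 0 t, y + s • u ∈ cube d)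
    (hL : ∀ s ∈ Icc 0 t, lagrangian P p i (y + s • u) v ≤ (B : EReal)) :
    quasiPotential P p i 0 (y + t • u) ≤ quasiPotential P p i 0 y + ENNReal.ofReal (t * B) := by
  conv_rhs => unfold quasiPotential
  simp only [ENNReal.iInf_add]
  refine le_iInf fun T => le_iInf fun φ => le_iInf fun h => ?_
  obtain ⟨hT, h0, hTy⟩ := h
  unfold action
  simp only [ENNReal.iInf_add]
  refine le_iInf fun ψ => le_iInf fun h => ?_
  obtain ⟨-, hac, hψ⟩ := h
  refine (quasiPotential_le (T := T + t) (φ := extend φ T u) (ψ := extend ψ T v) (by linarith)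
    (by rw [extend_of_le hT.le, h0])
    (by rw [extend_of_ge (by linarith), hTy, add_sub_cancel_left])
    (absolutelyContinuousOnInterval_extend hT.le ht hac v)
    (hψ.extend hT.le (by rwa [hTy]) (by rwa [hTy]))).trans ?_
  rw [← Ioc_union_Ioc_eq_Ioc hT.le (by linarith : T ≤ T + t),
    lintegral_union measurableSet_Ioc (Ioc_disjoint_Ioc_of_le le_rfl)]
  refine add_le_add (le_of_eq (lintegral_congr_ae ?_)) ?_
  · filter_upwards [ae_restrict_mem measurableSet_Ioc,
      ae_restrict_of_ae (Measure.ae_ne volume T)] with s hs hs'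
    rw [extend_of_le hs.2, deriv_extend_of_lt (lt_of_le_of_ne hs.2 hs')]
  · calc _ ≤ ∫⁻ _ in Ioc T (T + t), ENNReal.ofReal B := by
          refine setLIntegral_mono measurable_const fun s hs => ?_
          rw [extend_of_ge hs.1.le, deriv_extend_of_gt hs.1, hTy]
          exact EReal.toENNReal_le_toENNReal (hL _ ⟨by linarith [hs.1], by linarith [hs.2]⟩)
      _ = _ := by
          rw [setLIntegral_const, Real.volume_Ioc, add_sub_cancel_left, mul_comm,
            ENNReal.ofReal_mul ht]

variable [DecidableEq E]

lemma quasiPotential_zero_lt_top (hP : P ∈ Matrix.rowStochastic ℝ E) (hp : IsStepLaw p)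
    (hSmooth : SmoothLaw p) (hElliptic : EllipticLaw p) (hirr : P.IsIrreducible) (i : E) :
    quasiPotential P p i 0 0 < ⊤ := by
  obtain ⟨C, hC⟩ := exists_lagrangian_le hP hp hSmooth hElliptic hirr i
  -- The path that stays at the origin for one unit of time, as a path of length zero is not
  -- allowed.
  have href : IsReflection 1 (fun _ => (0 : Space d)) (fun _ => 0) := by
    refine ⟨continuousOn_const, continuousOn_const, fun _ _ => zero_mem_cube, 0, fun _ => 0,
      inferInstance, measurable_const, fun t _ => ?_, by simp, by simp⟩
    simpa using eVariationOn.constant_on (f := fun _ : ℝ => (0 : Space d)) (s := Icc 0 t)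
      ((subsingleton_singleton (a := (0 : Space d))).anti (by rintro _ ⟨_, -, rfl⟩; simp))
  have hac : AbsolutelyContinuousOnInterval (fun _ : ℝ => (0 : Space d)) 0 1 :=
    (LipschitzWith.const (0 : Space d)).lipschitzOnWith.absolutelyContinuousOnInterval
  refine (quasiPotential_le one_pos rfl rfl hac href).trans_lt ?_
  refine lt_of_le_of_lt (b := ∫⁻ _ in Ioc (0 : ℝ) 1, ENNReal.ofReal C) ?_ (by simp)
  refine lintegral_mono fun s => ?_
  simp only [deriv_const]
  exact EReal.toENNReal_le_toENNReal (hC 0 zero_mem_cube 0 (by simp))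

/-- The quasi-potential is finite on the cube. -/
lemma quasiPotential_lt_top (hP : P ∈ Matrix.rowStochastic ℝ E) (hp : IsStepLaw p)
    (hSmooth : SmoothLaw p) (hElliptic : EllipticLaw p) (hirr : P.IsIrreducible) (i : E)
    {x : Space d} (hx : x ∈ cube d) : quasiPotential P p i 0 x < ⊤ := by
  obtain ⟨C, hC⟩ := exists_lagrangian_le hP hp hSmooth hElliptic hirr i
  -- Reaching `x` along the segment in time `d + 1` keeps the `ℓ¹`-norm of the velocity at most one;
  -- the added one keeps the time positive.
  set t : ℝ := d + 1 with ht
  have ht0 : 0 < t := by positivity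
  have hcube : ∀ s ∈ Icc 0 t, (0 : Space d) + s • (t⁻¹ • x) ∈ cube d := fun s hs l => by
    have h1 : s * t⁻¹ ≤ 1 := by
      rw [← div_eq_mul_inv]
      exact div_le_one_of_le₀ hs.2 ht0.le
    have h2 : 0 ≤ s * t⁻¹ := mul_nonneg hs.1 (inv_nonneg.2 ht0.le)
    have := hx l
    simp only [zero_add, smul_smul, PiLp.smul_apply, smul_eq_mul]
    exact ⟨mul_nonneg h2 this.1, mul_le_one₀ h1 this.1 this.2⟩
  have hu : ∑ l, |(t⁻¹ • x) l| ≤ 1 := by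
    calc ∑ l, |(t⁻¹ • x) l| ≤ ∑ _l : Fin d, t⁻¹ := Finset.sum_le_sum fun l _ => by
          have := hx l
          rw [PiLp.smul_apply, smul_eq_mul, abs_of_nonneg
            (mul_nonneg (inv_nonneg.2 ht0.le) this.1)]
          exact mul_le_of_le_one_right (inv_nonneg.2 ht0.le) this.2
      _ = d * t⁻¹ := by simp
      _ ≤ 1 := by
          rw [← div_eq_mul_inv]
          exact div_le_one_of_le₀ (by linarith) ht0.le
  have h := quasiPotential_add_le (P := P) (p := p) (i := i) ht0.le
    (fun l => Or.inl rfl : IsReflectedVelocity 0 (t⁻¹ • x) (t⁻¹ • x)) hcube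
    (fun s hs => hC _ (hcube s hs) _ hu)
  rw [zero_add, smul_smul, mul_inv_cancel₀ ht0.ne', one_smul] at h
  exact h.trans_lt (ENNReal.add_lt_top.2
    ⟨quasiPotential_zero_lt_top hP hp hSmooth hElliptic hirr i, ENNReal.ofReal_lt_top⟩)

end Potential

/-! ### The inequality `H(x, ∇₊V(x)) ≤ 0` -/

section UpperBound

variable {d : ℕ} {E : Type*} [Fintype E] [DecidableEq E] {P : Matrix E E ℝ}
  {p : Space d → E → Step d → ℝ}

lemma potential_add_le (hP : P ∈ Matrix.rowStochastic ℝ E) (hp : IsStepLaw p)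
    (hSmooth : SmoothLaw p) (hElliptic : EllipticLaw p) (hirr : P.IsIrreducible) {i : E}
    {y v u : Space d} {t B : ℝ} (ht : 0 ≤ t) (hB : 0 ≤ B)
    (hvu : IsReflectedVelocity y v u) (hcube : ∀ s ∈ Icc 0 t, y + s • u ∈ cube d)
    (hL : ∀ s ∈ Icc 0 t, lagrangian P p i (y + s • u) v ≤ (B : EReal)) :
    potential P p i (y + t • u) ≤ potential P p i y + t * B := by
  have hy : y ∈ cube d := by simpa using hcube 0 ⟨le_rfl, ht⟩
  have hfin := (quasiPotential_lt_top hP hp hSmooth hElliptic hirr i hy).ne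
  have h := ENNReal.toReal_mono (ENNReal.add_ne_top.2 ⟨hfin, ENNReal.ofReal_ne_top⟩)
    (quasiPotential_add_le ht hvu hcube hL)
  rwa [ENNReal.toReal_add hfin ENNReal.ofReal_ne_top, ENNReal.toReal_ofReal (by positivity)] at h

lemma hasDerivWithinAt_comp_add_smul {V : Space d → ℝ} {S : Set (Space d)} {x w : Space d}
    (hV : DifferentiableWithinAt ℝ V S x)
    (hw : ∀ᶠ t : ℝ in 𝓝[>] 0, x + t • w ∈ S) :
    HasDerivWithinAt (fun t : ℝ => V (x + t • w)) ⟪gradientWithin V S x, w⟫ (Ioi 0) 0 := by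
  have hline : HasDerivWithinAt (fun t : ℝ => x + t • w) w (Ioi 0 ∩ {t | x + t • w ∈ S}) 0 := by
    simpa using (((hasDerivAt_id (0 : ℝ)).smul_const w).const_add x).hasDerivWithinAt
  have hV' : HasFDerivWithinAt V (fderivWithin ℝ V S x) S (x + (0 : ℝ) • w) := by
    simpa using hV.hasFDerivWithinAt
  have h := hV'.comp_hasDerivWithinAt (0 : ℝ) hline fun t ht => ht.2
  rw [← hasDerivWithinAt_inter' (t := {t | x + t • w ∈ S}) hw]
  have e : ⟪gradientWithin V S x, w⟫ = fderivWithin ℝ V S x w :=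
    InnerProductSpace.toDual_symm_apply
  rw [e]
  exact h

/-- The derivative of the potential along a reflected velocity is at most the Lagrangian. -/
lemma inner_gradientWithin_le (hP : P ∈ Matrix.rowStochastic ℝ E) (hp : IsStepLaw p)
    (hSmooth : SmoothLaw p) (hElliptic : EllipticLaw p) (hirr : P.IsIrreducible) {i : E}
    {x c v u : Space d} {b t₀ : ℝ} (hx : x ∈ cube d \ {0}) (hb : 0 ≤ b) (ht₀ : 0 < t₀)
    (hV : DifferentiableWithinAt ℝ (potential P p i) (cube d \ {0}) x)
    (hvu : ∀ t : ℝ, IsReflectedVelocity (x + t • c) v u)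
    (hcube : ∀ t ∈ Icc 0 t₀, ∀ s ∈ Icc 0 t, x + t • c + s • u ∈ cube d)
    (hL : ∀ α, ⟪α, v⟫ - hamiltonian P p i x α ≤ b) :
    ⟪gradientWithin (potential P p i) (cube d \ {0}) x, u⟫ ≤ b := by
  obtain ⟨C, hC0, hC⟩ := exists_hamiltonian_lipschitz_left hP hp hSmooth hElliptic hirr i
  have hne : ∀ w : Space d, ∀ᶠ t : ℝ in 𝓝[>] 0, x + t • w ≠ 0 := fun w => by
    have : Tendsto (fun t : ℝ => x + t • w) (𝓝[>] 0) (𝓝 x) := by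
      have h : Continuous fun t : ℝ => x + t • w := by fun_prop
      simpa using (h.tendsto 0).mono_left nhdsWithin_le_nhds
    exact this.eventually_ne hx.2
  have hIcc : ∀ᶠ t : ℝ in 𝓝[>] 0, t ∈ Icc 0 t₀ := by
    filter_upwards [Ioo_mem_nhdsGT ht₀] with t ht
    exact Ioo_subset_Icc_self ht
  have h1 : ∀ᶠ t : ℝ in 𝓝[>] 0, x + t • c ∈ cube d \ {0} := by
    filter_upwards [hne c, hIcc] with t ht ht'
    exact ⟨by simpa using hcube t ht' 0 ⟨le_rfl, ht'.1⟩, ht⟩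
  have h2 : ∀ᶠ t : ℝ in 𝓝[>] 0, x + t • (c + u) ∈ cube d \ {0} := by
    filter_upwards [hne (c + u), hIcc] with t ht ht'
    exact ⟨by simpa [smul_add, add_assoc] using hcube t ht' t ⟨ht'.1, le_rfl⟩, ht⟩
  -- The motion starts from `x + t • c` rather than from `x`; in the increment from `x + t • c` to
  -- `x + t • (c + u)` the contributions of `c` cancel, leaving the derivative along `u`.
  have hd := (hasDerivWithinAt_comp_add_smul hV h2).sub (hasDerivWithinAt_comp_add_smul hV h1)
  rw [← inner_sub_right, add_sub_cancel_left, hasDerivWithinAt_iff_tendsto_slope'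
    self_notMem_Ioi] at hd
  have hlim : Tendsto (fun t : ℝ => b + C * (t * (‖c‖ + ‖u‖))) (𝓝[>] 0) (𝓝 b) := by
    have h : Continuous fun t : ℝ => b + C * (t * (‖c‖ + ‖u‖)) := by fun_prop
    simpa using (h.tendsto 0).mono_left nhdsWithin_le_nhds
  refine le_of_tendsto_of_tendsto hd hlim ?_
  filter_upwards [hIcc, self_mem_nhdsWithin] with t ht ht0
  have ht0' : 0 < t := ht0
  -- `B` is the bound `b` at `x` plus the error of moving the base point of the Lagrangian, which
  -- vanishes as `t → 0`.
  have key := potential_add_le hP hp hSmooth hElliptic hirr (i := i) (y := x + t • c) (v := v)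
    (u := u) (t := t) (B := b + C * (t * (‖c‖ + ‖u‖))) ht.1 (by positivity) (hvu t) (hcube t ht)
    fun s hs => iSup_le fun α => by
      rw [EReal.coe_le_coe_iff]
      have e1 := hC x hx.1 _ (hcube t ht s hs) α
      have e2 : ‖x - (x + t • c + s • u)‖ ≤ t * (‖c‖ + ‖u‖) := by
        calc ‖x - (x + t • c + s • u)‖ = ‖t • c + s • u‖ := by
              rw [← norm_neg]
              congr 1
              abel
          _ ≤ t * ‖c‖ + s * ‖u‖ := by
              refine (norm_add_le _ _).trans_eq ?_
              rw [norm_smul, norm_smul, Real.norm_of_nonneg ht.1, Real.norm_of_nonneg hs.1]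
          _ ≤ t * (‖c‖ + ‖u‖) := by
              rw [mul_add]
              have := hs.2
              gcongr
      have e3 := mul_le_mul_of_nonneg_left e2 hC0
      linarith [hL α]
  have e : x + t • c + t • u = x + t • (c + u) := by rw [smul_add, add_assoc]
  rw [e] at key
  simp only [slope, sub_zero, vsub_eq_sub, smul_eq_mul, Pi.sub_apply, zero_smul, add_zero,
    sub_self]
  rw [inv_mul_le_iff₀ ht0']
  linarith

lemma gradPlus_apply (V : Space d → ℝ) (x : Space d) (l : Fin d) :
    gradPlus V x l =
      if x l = 0 then min (gradientWithin V (cube d \ {0}) x l) 0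
      else if x l = 1 then max (gradientWithin V (cube d \ {0}) x l) 0
      else gradientWithin V (cube d \ {0}) x l := rfl

/-- A separating affine minorant of `H(x, ·)` supplies a velocity `v` with `L(x, v) < ⟪β, v⟫`, too
cheap for the growth of `V` along the reflected motion. -/
lemma hamiltonian_gradPlus_nonpos (hP : P ∈ Matrix.rowStochastic ℝ E) (hp : IsStepLaw p)
    (hSmooth : SmoothLaw p) (hElliptic : EllipticLaw p) (hirr : P.IsIrreducible) {i : E}
    {x : Space d} (hx : x ∈ cube d \ {0})
    (hV : DifferentiableWithinAt ℝ (potential P p i) (cube d \ {0}) x) :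
    hamiltonian P p i x (gradPlus (potential P p i) x) ≤ 0 := by
  by_contra! hpos
  set β := gradPlus (potential P p i) x with hβ
  set g := gradientWithin (potential P p i) (cube d \ {0}) x with hg
  obtain ⟨a, ha, ha'⟩ := exists_between hpos
  obtain ⟨f, c, hfc, hfa⟩ := ConvexOn.exists_affine_le_of_lt (𝕜 := ℝ) (mem_univ β) ha' isClosed_univ
    ((continuous_hamiltonian hP hp hirr i x).lowerSemicontinuous.lowerSemicontinuousOn _)
    (convexOn_hamiltonian hP hp hirr i x)
  set v : Space d := (InnerProductSpace.toDual ℝ (Space d)).symm f with hv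
  have hfv : ∀ α, f α = ⟪α, v⟫ := fun α => by
    rw [real_inner_comm, hv, InnerProductSpace.toDual_symm_apply]
  have hle : ∀ α, ⟪α, v⟫ + c ≤ hamiltonian P p i x α := fun α => by
    simpa [hfv] using hfc ⟨α, mem_univ α⟩
  have hβa : ⟪β, v⟫ + c = a := by simpa [hfv] using hfa
  have hc : c ≤ 0 := by simpa [hamiltonian_zero hP hp hirr] using hle 0
  classical
  -- The coordinates to cancel: `v` points outwards, and `∇₊V` truncates the partial derivative to
  -- zero. Elsewhere `u` keeps `v`, even if it points outwards, because there `β l * v l ≤ g l * v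
  -- l`.
  set S : Set (Fin d) := {l | (x l = 0 ∧ v l ≤ 0 ∧ 0 < g l) ∨ (x l = 1 ∧ 0 ≤ v l ∧ g l < 0)} with hS
  set u : Space d := WithLp.toLp 2 fun l => if l ∈ S then 0 else v l with hu
  -- Shifting the start to `x + t • w` makes room for the outward coordinates that are kept: it
  -- moves inwards by `t * ‖v‖`, enough for a motion of duration `t`. It does not move the cancelled
  -- coordinates, so reflection remains available there.
  set w : Space d := WithLp.toLp 2 fun l =>
    if l ∈ S then 0 else if x l = 0 then ‖v‖ else if x l = 1 then -‖v‖ else 0 with hw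
  have hu' : ∀ l, u l = if l ∈ S then 0 else v l := fun l => rfl
  have hw' : ∀ l, w l = if l ∈ S then 0 else if x l = 0 then ‖v‖ else if x l = 1 then -‖v‖ else 0 :=
    fun l => rfl
  have hvn : ∀ l, |v l| ≤ ‖v‖ := fun l => PiLp.norm_apply_le v l
  have hinner : ⟪β, v⟫ ≤ ⟪g, u⟫ := by
    simp only [PiLp.inner_apply, RCLike.inner_apply, conj_trivial]
    refine Finset.sum_le_sum fun l _ => ?_
    rw [hβ, gradPlus_apply, hu', ← hg]
    by_cases h0 : x l = 0
    · rcases le_or_gt (g l) 0 with h | h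
      · have : l ∉ S := by simp [hS, h0, h.not_gt]
        simp [h0, this, h]
      · rcases le_or_gt (v l) 0 with h' | h'
        · have : l ∈ S := by simp [hS, h0, h, h']
          simp [h0, this, h.le]
        · have : l ∉ S := by simp [hS, h0, h'.not_ge]
          simp [h0, this, h.le]
          positivity
    · by_cases h1 : x l = 1
      · rcases le_or_gt 0 (g l) with h | h
        · have : l ∉ S := by simp [hS, h1, h.not_gt]
          simp [h1, this, h]
        · rcases le_or_gt 0 (v l) with h' | h'
          · have : l ∈ S := by simp [hS, h1, h, h']
            simp [h1, this, h.le]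
          · have : l ∉ S := by simp [hS, h1, h'.not_ge]
            simp only [h1, this, one_ne_zero, if_true, if_false, max_eq_right h.le, mul_zero]
            exact (mul_pos_of_neg_of_neg h' h).le
      · have : l ∉ S := by simp [hS, h0, h1]
        simp [h0, h1, this]
  have hcubel : ∀ l, ∀ᶠ t₀ : ℝ in 𝓝[>] 0, ∀ t ∈ Icc 0 t₀, ∀ s ∈ Icc 0 t,
      x l + t * w l + s * u l ∈ Icc (0 : ℝ) 1 := fun l => by
    have hxl := hx.1 l
    have hsv : ∀ t s : ℝ, s ∈ Icc 0 t → -(t * ‖v‖) ≤ s * v l ∧ s * v l ≤ t * ‖v‖ :=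
      fun t s hs => abs_le.1 <| by
        rw [abs_mul, abs_of_nonneg hs.1]
        exact mul_le_mul hs.2 (hvn l) (abs_nonneg _) (hs.1.trans hs.2)
    have hsmall : ∀ r : ℝ, 0 < r → ∀ᶠ t₀ : ℝ in 𝓝[>] 0, ∀ t ∈ Icc 0 t₀, t * ‖v‖ < r :=
      fun r hr => by
        have h : Continuous fun t : ℝ => t * ‖v‖ := by fun_prop
        have h' : Tendsto (fun t : ℝ => t * ‖v‖) (𝓝[>] 0) (𝓝 0) := by
          simpa using (h.tendsto 0).mono_left nhdsWithin_le_nhds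
        filter_upwards [h'.eventually_lt_const hr] with t₀ ht₀ t ht
        exact (mul_le_mul_of_nonneg_right ht.2 (norm_nonneg _)).trans_lt ht₀
    rw [hu', hw']
    by_cases hl : l ∈ S
    · simp only [hl, if_true, mul_zero, add_zero]
      exact Eventually.of_forall fun _ _ _ _ _ => hxl
    by_cases h0 : x l = 0
    · filter_upwards [hsmall (1 / 2) (by norm_num)] with t₀ ht₀ t ht s hs
      have := hsv t s hs
      have := ht₀ t ht
      simp only [hl, h0, if_true, if_false]
      constructor <;> linarith
    by_cases h1 : x l = 1
    · filter_upwards [hsmall (1 / 2) (by norm_num)] with t₀ ht₀ t ht s hs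
      have := hsv t s hs
      have := ht₀ t ht
      simp only [hl, h1, one_ne_zero, if_true, if_false]
      constructor <;> linarith
    · filter_upwards [hsmall (x l) (lt_of_le_of_ne hxl.1 (Ne.symm h0)),
        hsmall (1 - x l) (sub_pos.2 (lt_of_le_of_ne hxl.2 h1))] with t₀ ht₀ ht₁ t ht s hs
      have := hsv t s hs
      have := ht₀ t ht
      have := ht₁ t ht
      simp only [hl, h0, h1, if_false]
      constructor <;> linarith
  obtain ⟨t₀, hcube, ht₀⟩ := ((eventually_all.2 hcubel).and self_mem_nhdsWithin).exists
  have hfinal := inner_gradientWithin_le hP hp hSmooth hElliptic hirr (i := i) (c := w) (v := v)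
    (u := u) (b := -c) hx (neg_nonneg.2 hc) ht₀ hV (fun t l => ?_)
    (fun t ht s hs l => hcube l t ht s hs) (fun α => by linarith [hle α])
  -- `a - c = ⟪β, v⟫ ≤ ⟪g, u⟫ ≤ -c` contradicts `0 < a`.
  · linarith
  · by_cases hl : l ∈ S
    · right
      have hwl : (x + t • w) l = x l := by simp [hw', hl]
      rw [hwl, hu', if_pos hl]
      rcases hl with ⟨h1, h2, -⟩ | ⟨h1, h2, -⟩
      · exact Or.inl ⟨h1, h2, rfl⟩
      · exact Or.inr ⟨h1, h2, rfl⟩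
    · left
      rw [hu', if_neg hl]

end UpperBound

/-! ### The inequality `H(x, ∇₊V(x)) ≥ 0` -/

section LowerBound

variable {d : ℕ}

lemma IsReflection.mono {T τ : ℝ} (hτ : τ ≤ T) {ψ φ : ℝ → Space d} (h : IsReflection T ψ φ) :
    IsReflection τ ψ φ := by
  obtain ⟨hψ, hφ, hφc, μ, n, hμ, hn, hvar, hae, hint⟩ := h
  have hIcc : Icc 0 τ ⊆ Icc 0 T := Icc_subset_Icc_right hτ
  exact ⟨hψ.mono hIcc, hφ.mono hIcc, fun t ht => hφc t (hIcc ht), μ, n, hμ, hn,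
    fun t ht => hvar t (hIcc ht),
    ae_restrict_of_ae_restrict_of_subset (Ioc_subset_Ioc_right hτ) hae,
    fun t ht => hint t (hIcc ht)⟩

/-- The pushing process does not decrease in a direction that points outwards on the faces
visited by the path. -/
lemma IsReflection.inner_sub_le {T τ : ℝ} (hτ0 : 0 ≤ τ) (hτ : τ ≤ T) {ψ φ : ℝ → Space d}
    (h : IsReflection T ψ φ) {γ : Space d}
    (hγ : ∀ s ∈ Ioc τ T, ∀ l, (φ s l = 0 → γ l ≤ 0) ∧ (φ s l = 1 → 0 ≤ γ l)) :
    ⟪γ, φ T - φ τ⟫ ≤ ⟪γ, ψ T⟫ - ⟪γ, ψ τ⟫ := by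
  obtain ⟨-, -, hφc, μ, n, hμ, hn, -, hae, hint⟩ := h
  have hi := integrableOn_of_ae_mem_normals hn hae
  have hsub : Ioc τ T ⊆ Ioc 0 T := Ioc_subset_Ioc_left hτ0
  have hk : (ψ T - φ T) - (ψ τ - φ τ) = ∫ s in Ioc τ T, n s ∂μ := by
    rw [hint T ⟨hτ0.trans hτ, le_rfl⟩, hint τ ⟨hτ0, hτ⟩, sub_eq_iff_eq_add',
      ← setIntegral_union (Ioc_disjoint_Ioc_of_le le_rfl) measurableSet_Ioc
        (hi.mono_set (Ioc_subset_Ioc_right hτ)) (hi.mono_set hsub), Ioc_union_Ioc_eq_Ioc hτ0 hτ]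
  have hnn : 0 ≤ ⟪γ, ∫ s in Ioc τ T, n s ∂μ⟫ := by
    rw [← integral_inner (hi.mono_set hsub)]
    refine integral_nonneg_of_ae ?_
    filter_upwards [ae_restrict_of_ae_restrict_of_subset hsub hae,
      ae_restrict_mem measurableSet_Ioc] with s hs hs'
    rw [PiLp.inner_apply]
    refine Finset.sum_nonneg fun l _ => ?_
    simp only [RCLike.inner_apply, conj_trivial]
    obtain ⟨h1, h2, h3⟩ := hs.2.2 l
    have hc := hφc s ⟨(hsub hs').1.le, hs'.2⟩ l
    rcases hc.1.eq_or_lt with h0 | h0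
    · exact mul_nonneg_of_nonpos_of_nonpos (h2 h0.symm) ((hγ s hs' l).1 h0.symm)
    rcases hc.2.eq_or_lt with h0' | h0'
    · exact mul_nonneg (h3 h0') ((hγ s hs' l).2 h0')
    · simp [h1 ⟨h0, h0'⟩]
  rw [← hk] at hnn
  simp only [inner_sub_right] at hnn ⊢
  linarith

lemma absolutelyContinuousOnInterval_inner {f : ℝ → Space d} {a b : ℝ} (γ : Space d)
    (hf : AbsolutelyContinuousOnInterval f a b) :
    AbsolutelyContinuousOnInterval (fun s => ⟪γ, f s⟫) a b := by
  refine squeeze_zero (fun I => Finset.sum_nonneg fun k _ => dist_nonneg) (fun I => ?_)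
    (by simpa using Tendsto.const_mul ‖γ‖ hf)
  rw [Finset.mul_sum]
  refine Finset.sum_le_sum fun k _ => ?_
  rw [Real.dist_eq, ← inner_sub_right, dist_eq_norm]
  exact abs_real_inner_le_norm _ _

/-- The fundamental theorem of calculus for `⟪γ, f⟫`, discarding the negative part of the
derivative. -/
lemma ofReal_sub_le_lintegral_inner_deriv {f : ℝ → Space d} {a b : ℝ} (hab : a ≤ b) (γ : Space d)
    (hf : AbsolutelyContinuousOnInterval f a b) :
    ENNReal.ofReal (⟪γ, f b⟫ - ⟪γ, f a⟫) ≤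
      ∫⁻ s in Ioc a b, ENNReal.ofReal ⟪γ, deriv f s⟫ := by
  have hF := absolutelyContinuousOnInterval_inner γ hf
  have hFi := hF.intervalIntegrable_deriv
  rw [intervalIntegrable_iff_integrableOn_Ioc_of_le hab] at hFi
  have hae : ∀ᵐ s ∂volume.restrict (Ioc a b),
      ENNReal.ofReal (deriv (fun s => ⟪γ, f s⟫) s) = ENNReal.ofReal ⟪γ, deriv f s⟫ := by
    filter_upwards [ae_restrict_mem measurableSet_Ioc,
      ae_restrict_of_ae hf.boundedVariationOn.ae_differentiableAt_of_mem_uIcc] with s hs hs'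
    rw [uIcc_of_le hab] at hs'
    have := ((hasDerivAt_const s γ).inner ℝ (hs' (Ioc_subset_Icc_self hs)).hasDerivAt).deriv
    rw [this]
    simp
  rw [← hF.integral_deriv_eq_sub, intervalIntegral.integral_of_le hab, ← lintegral_congr_ae hae,
    integral_eq_lintegral_pos_part_sub_lintegral_neg_part hFi]
  refine ENNReal.ofReal_le_of_le_toReal (sub_le_self _ ENNReal.toReal_nonneg)

/-- The last time at which a path is at distance at least `r` from its endpoint. -/
lemma exists_last_exit {T r : ℝ} {φ : ℝ → Space d} (hT : 0 ≤ T) (hφ : ContinuousOn φ (Icc 0 T))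
    (hr : 0 < r) (h0 : r < ‖φ 0 - φ T‖) :
    ∃ τ ∈ Ioo 0 T, ‖φ τ - φ T‖ = r ∧ ∀ s ∈ Ioc τ T, ‖φ s - φ T‖ < r := by
  have hcont : ContinuousOn (fun s => ‖φ s - φ T‖) (Icc 0 T) :=
    (hφ.sub continuousOn_const).norm
  have hcomp : IsCompact (Icc 0 T ∩ (fun s => ‖φ s - φ T‖) ⁻¹' Ici r) :=
    isCompact_Icc.of_isClosed_subset (hcont.preimage_isClosed_of_isClosed isClosed_Icc isClosed_Ici)
      inter_subset_left
  obtain ⟨τ, ⟨hτ, hτr⟩, hmax⟩ := hcomp.exists_isGreatest ⟨0, ⟨le_rfl, hT⟩, h0.le⟩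
  have hlt : ∀ s ∈ Ioc τ T, ‖φ s - φ T‖ < r := fun s hs => by
    by_contra! h
    exact (hmax ⟨⟨hτ.1.trans hs.1.le, hs.2⟩, h⟩).not_gt hs.1
  have hτT : τ < T := hτ.2.lt_of_ne fun h => by
    simp only [h, mem_preimage, sub_self, norm_zero, mem_Ici] at hτr
    exact hτr.not_gt hr
  have heq : ‖φ τ - φ T‖ = r := by
    refine le_antisymm ?_ hτr
    have := left_nhdsWithin_Ioc_neBot hτT
    refine le_of_tendsto ((hcont τ hτ).mono fun s (hs : s ∈ Ioc τ T) => ⟨hτ.1.trans hs.1.le, hs.2⟩) ?_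
    filter_upwards [self_mem_nhdsWithin] with s hs
    exact (hlt s hs).le
  refine ⟨τ, ⟨hτ.1.lt_of_ne fun h => ?_, hτT⟩, heq, hlt⟩
  rw [← h] at heq
  exact h0.ne' heq

variable {E : Type*} [Fintype E] {P : Matrix E E ℝ} {p : Space d → E → Step d → ℝ}

lemma inner_le_lagrangian {i : E} {y γ u : Space d} (h : hamiltonian P p i y γ ≤ 0) :
    ((⟪γ, u⟫ : ℝ) : EReal) ≤ lagrangian P p i y u :=
  le_iSup_of_le γ (EReal.coe_le_coe_iff.2 (by linarith))

lemma gradPlus_nonpos {V : Space d → ℝ} {x : Space d} {l : Fin d} (h : x l = 0) :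
    gradPlus V x l ≤ 0 := by
  simp [gradPlus_apply, h]

lemma gradPlus_nonneg {V : Space d → ℝ} {x : Space d} {l : Fin d} (h : x l = 1) :
    0 ≤ gradPlus V x l := by
  simp [gradPlus_apply, h]

/-- On a face only inward displacements are possible, and the truncation in `∇₊V` can only decrease
the product with these. -/
lemma inner_gradPlus_le (V : Space d → ℝ) {x y : Space d} (hy : y ∈ cube d) :
    ⟪gradPlus V x, y - x⟫ ≤ ⟪gradientWithin V (cube d \ {0}) x, y - x⟫ := by
  simp only [PiLp.inner_apply, RCLike.inner_apply, conj_trivial, PiLp.sub_apply]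
  refine Finset.sum_le_sum fun l _ => ?_
  rw [gradPlus_apply]
  have := hy l
  split_ifs with h0 h1
  · exact mul_le_mul_of_nonneg_left (min_le_left _ _) (by linarith [this.1])
  · exact mul_le_mul_of_nonpos_left (le_max_left _ _) (by linarith [this.2])
  · exact le_rfl

variable [DecidableEq E]

/-- If `H(x, β)` were negative, a tilt of `β` would give a linear lower bound for the cost near `x`
that beats the linearisation of `V` by a fixed amount on every path. -/
lemma hamiltonian_gradPlus_nonneg (hP : P ∈ Matrix.rowStochastic ℝ E) (hp : IsStepLaw p)
    (hSmooth : SmoothLaw p) (hElliptic : EllipticLaw p) (hirr : P.IsIrreducible) {i : E}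
    {x : Space d} (hx : x ∈ cube d \ {0})
    (hV : DifferentiableWithinAt ℝ (potential P p i) (cube d \ {0}) x) :
    0 ≤ hamiltonian P p i x (gradPlus (potential P p i) x) := by
  by_contra! hneg
  obtain ⟨C, hC0, hC⟩ := exists_hamiltonian_lipschitz_left hP hp hSmooth hElliptic hirr i
  set V := potential P p i with hVdef
  set β := gradPlus V x with hβ
  -- The gap `-H(x, β) = 2η` is spent in two halves: `η` on the tilt of `β`, and `η` on moving the
  -- base point within distance `r` (whence `C * r ≤ η`).
  set η := -hamiltonian P p i x β / 2 with hη
  have hη0 : 0 < η := by rw [hη]; linarith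
  have hxn : 0 < ‖x‖ := norm_pos_iff.2 hx.2
  have hloc : ∃ r₁ > 0, ∀ y ∈ cube d \ {0}, ‖y - x‖ < r₁ →
      V x + ⟪β, y - x⟫ - η / 2 * ‖y - x‖ ≤ V y := by
    have h := hV.hasFDerivWithinAt.isLittleO.def (half_pos hη0)
    obtain ⟨r₁, hr₁, h⟩ := Metric.mem_nhdsWithin_iff.1 h
    refine ⟨r₁, hr₁, fun y hy hyx => ?_⟩
    have h1 : |V y - V x - fderivWithin ℝ V (cube d \ {0}) x (y - x)| ≤ η / 2 * ‖y - x‖ :=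
      h ⟨mem_ball_iff_norm.2 hyx, hy⟩
    have h2 := (abs_le.1 h1).1
    have h3 : ⟪gradientWithin V (cube d \ {0}) x, y - x⟫ =
        fderivWithin ℝ V (cube d \ {0}) x (y - x) := InnerProductSpace.toDual_symm_apply
    have h4 := inner_gradPlus_le V (x := x) hy.1
    linarith
  obtain ⟨r₁, hr₁, hloc⟩ := hloc
  -- The ball of radius `r` lies where the expansion of `V` is valid, excludes the origin (so paths
  -- from `0` must enter it), and meets only the faces containing `x`.
  have hr : ∃ r > 0, r < r₁ ∧ r < ‖x‖ ∧ C * r ≤ η ∧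
      ∀ l, (x l ≠ 0 → r < x l) ∧ (x l ≠ 1 → r < 1 - x l) := by
    have hlt : ∀ a : ℝ, 0 < a → ∀ᶠ r : ℝ in 𝓝[>] 0, r < a := fun a ha =>
      (eventually_lt_nhds ha).filter_mono nhdsWithin_le_nhds
    have hCr : ∀ᶠ r : ℝ in 𝓝[>] 0, C * r ≤ η := by
      have h : Continuous fun r : ℝ => C * r := by fun_prop
      have h' : Tendsto (fun r : ℝ => C * r) (𝓝[>] 0) (𝓝 0) := by
        simpa using (h.tendsto 0).mono_left nhdsWithin_le_nhds
      exact h'.eventually_le_const hη0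
    have hl : ∀ l, ∀ᶠ r : ℝ in 𝓝[>] 0, (x l ≠ 0 → r < x l) ∧ (x l ≠ 1 → r < 1 - x l) := fun l => by
      have h1 := hx.1 l
      refine .and ?_ ?_
      · by_cases h : x l = 0
        · simp [h]
        · filter_upwards [hlt _ (h1.1.lt_of_ne (Ne.symm h))] with r hr _ using hr
      · by_cases h : x l = 1
        · simp [h]
        · filter_upwards [hlt _ (sub_pos.2 (h1.2.lt_of_ne h))] with r hr _ using hr
    obtain ⟨r, h1, h2, h3, h4, h5⟩ := (eventually_mem_nhdsWithin.and <| (hlt _ hr₁).and <|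
      (hlt _ hxn).and <| hCr.and <| eventually_all.2 hl).exists
    exact ⟨r, h1, h2, h3, h4, h5⟩
  obtain ⟨r, hr0, hrr₁, hrx, hrC, hrl⟩ := hr
  have hmain : ENNReal.ofReal (V x + η / 2 * r) ≤ quasiPotential P p i 0 x := by
    refine le_iInf fun T => le_iInf fun φ => le_iInf fun ⟨hT, h0, hTx⟩ => ?_
    refine le_iInf fun ψ => le_iInf fun ⟨_, hac, hψ⟩ => ?_
    obtain ⟨τ, hτ, hτr, hball⟩ := exists_last_exit hT.le hψ.2.1 hr0 (by simpa [h0, hTx] using hrx)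
    rw [hTx] at hτr hball
    have hτc : φ τ ∈ cube d := hψ.2.2.1 τ ⟨hτ.1.le, hτ.2.le⟩
    have hτ' : φ τ ∈ cube d \ {0} := ⟨hτc, fun h => by
      rw [mem_singleton_iff.1 h, zero_sub, norm_neg] at hτr
      exact hrx.ne' hτr⟩
    set e : Space d := r⁻¹ • (x - φ τ) with he
    have hen : ‖e‖ = 1 := by
      rw [he, norm_smul, norm_inv, Real.norm_of_nonneg hr0.le, norm_sub_rev, hτr,
        inv_mul_cancel₀ hr0.ne']
    -- The tilt depends on the entrance point `φ τ`: it gains `η * r` over the crossing. On faces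
    -- through `x` both `β` and `e` point outwards (weakly), so `γ` does too.
    set γ := β + η • e with hγ
    have hγl : ∀ l, γ l = β l + η * (r⁻¹ * (x l - φ τ l)) := fun l => by simp [hγ, he]
    have hγ0 : ∀ l, x l = 0 → γ l ≤ 0 := fun l hl => by
      have h1 : β l ≤ 0 := gradPlus_nonpos hl
      have h2 : 0 ≤ η * (r⁻¹ * φ τ l) :=
        mul_nonneg hη0.le (mul_nonneg (inv_nonneg.2 hr0.le) (hτc l).1)
      rw [hγl, hl]
      linarith
    have hγ1 : ∀ l, x l = 1 → 0 ≤ γ l := fun l hl => by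
      have h1 : 0 ≤ β l := gradPlus_nonneg hl
      have h2 : 0 ≤ η * (r⁻¹ * (x l - φ τ l)) := mul_nonneg hη0.le
        (mul_nonneg (inv_nonneg.2 hr0.le) (by rw [hl]; linarith [(hτc l).2]))
      rw [hγl]
      linarith
    have hsign : ∀ s ∈ Ioc τ T, ∀ l, (φ s l = 0 → γ l ≤ 0) ∧ (φ s l = 1 → 0 ≤ γ l) := by
      intro s hs l
      have h1 := abs_lt.1 ((PiLp.norm_apply_le (φ s - x) l).trans_lt (hball s hs))
      rw [PiLp.sub_apply] at h1
      constructor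
      · intro h
        refine hγ0 l (by_contra fun hl => ?_)
        have := (hrl l).1 hl
        linarith
      · intro h
        refine hγ1 l (by_contra fun hl => ?_)
        have := (hrl l).2 hl
        linarith
    have hH : ∀ s ∈ Ioc τ T, hamiltonian P p i (φ s) γ ≤ 0 := fun s hs => by
      have h1 := hC (φ s) (hψ.2.2.1 s ⟨hτ.1.le.trans hs.1.le, hs.2⟩) x hx.1 γ
      have h2 := hamiltonian_lipschitz hP hp hirr i x γ β
      have h3 : ‖γ - β‖ = η := by
        rw [hγ, add_sub_cancel_left, norm_smul, hen, mul_one, Real.norm_of_nonneg hη0.le]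
      have h4 := mul_le_mul_of_nonneg_left (hball s hs).le hC0
      linarith
    have hleft : ENNReal.ofReal (V (φ τ)) ≤
        ∫⁻ s in Ioc 0 τ, (lagrangian P p i (φ s) (deriv ψ s)).toENNReal := by
      rw [hVdef, potential, ENNReal.ofReal_toReal
        (quasiPotential_lt_top hP hp hSmooth hElliptic hirr i hτc).ne]
      refine quasiPotential_le hτ.1 h0 rfl (hac.mono ?_) (hψ.mono hτ.2.le)
      rw [uIcc_of_le hτ.1.le, uIcc_of_le hT.le]
      exact Icc_subset_Icc_right hτ.2.le
    have hright : ENNReal.ofReal ⟪γ, x - φ τ⟫ ≤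
        ∫⁻ s in Ioc τ T, (lagrangian P p i (φ s) (deriv ψ s)).toENNReal := by
      have h1 := hψ.inner_sub_le hτ.1.le hτ.2.le hsign
      rw [hTx] at h1
      refine (ENNReal.ofReal_le_ofReal h1).trans <|
        (ofReal_sub_le_lintegral_inner_deriv hτ.2.le γ (hac.mono ?_)).trans ?_
      · rw [uIcc_of_le hτ.2.le, uIcc_of_le hT.le]
        exact Icc_subset_Icc_left hτ.1.le
      · refine setLIntegral_mono' measurableSet_Ioc fun s hs => ?_
        exact EReal.toENNReal_le_toENNReal (inner_le_lagrangian (hH s hs))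
    have hval : ⟪γ, x - φ τ⟫ = ⟪β, x - φ τ⟫ + η * r := by
      rw [hγ, inner_add_left, real_inner_smul_left, he, real_inner_smul_left,
        real_inner_self_eq_norm_sq, norm_sub_rev, hτr]
      field_simp
    have hVτ := hloc _ hτ' (hτr.trans_lt hrr₁)
    rw [hτr, ← neg_sub x (φ τ), inner_neg_right] at hVτ
    rw [← Ioc_union_Ioc_eq_Ioc hτ.1.le hτ.2.le,
      lintegral_union measurableSet_Ioc (Ioc_disjoint_Ioc_of_le le_rfl)]
    -- The expansion at `φ τ` loses `η / 2 * r` and the tilt gains `η * r`, while the `β` terms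
    -- cancel.
    refine le_trans ?_ (add_le_add hleft hright)
    refine (ENNReal.ofReal_le_ofReal ?_).trans ENNReal.ofReal_add_le
    linarith
  have hfin := (quasiPotential_lt_top hP hp hSmooth hElliptic hirr i hx.1).ne
  have h := (ENNReal.ofReal_le_iff_le_toReal hfin).1 hmain
  have : 0 < η / 2 * r := by positivity
  change V x + η / 2 * r ≤ V x at h
  linarith

/-- The Hamilton-Jacobi equation, in the cube and on its boundary. -/
lemma hamiltonian_gradPlus_eq_zero (hP : P ∈ Matrix.rowStochastic ℝ E) (hp : IsStepLaw p)
    (hSmooth : SmoothLaw p) (hElliptic : EllipticLaw p) (hirr : P.IsIrreducible) {i : E}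
    {x : Space d} (hx : x ∈ cube d \ {0})
    (hV : DifferentiableWithinAt ℝ (potential P p i) (cube d \ {0}) x) :
    hamiltonian P p i x (gradPlus (potential P p i) x) = 0 :=
  (hamiltonian_gradPlus_nonpos hP hp hSmooth hElliptic hirr hx hV).antisymm
    (hamiltonian_gradPlus_nonneg hP hp hSmooth hElliptic hirr hx hV)

end LowerBound

/-! ### The open cube and the final assembly -/

lemma isOpen_openCube {d : ℕ} : IsOpen (openCube d) := by
  simp only [openCube, ofPred_forall]
  exact isOpen_iInter_of_finite fun l => isOpen_Ioo.preimage (by fun_prop)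

/-- The index `l` rules out `d = 0`, where the open cube is the single point `0`. -/
lemma openCube_subset {d : ℕ} (l : Fin d) : openCube d ⊆ cube d \ {0} := fun x hx =>
  ⟨fun l => Ioo_subset_Icc_self (hx l), fun h => by
    have := (hx l).1
    simp [mem_singleton_iff.1 h] at this⟩

lemma gradPlus_eq_gradient {d : ℕ} (V : Space d → ℝ) {x : Space d} (hx : x ∈ openCube d)
    (l : Fin d) : gradPlus V x = gradient V x := by
  have hS : cube d \ {0} ∈ 𝓝 x := mem_of_superset (isOpen_openCube.mem_nhds hx) (openCube_subset l)
  have h : gradientWithin V (cube d \ {0}) x = gradient V x := by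
    rw [gradientWithin, gradient, fderivWithin_of_mem_nhds hS]
  refine PiLp.ext fun k => ?_
  rw [gradPlus_apply, if_neg (hx k).1.ne', if_neg (hx k).2.ne, h]

end ReflectedWalk

theorem mainTheorem8 {d : ℕ} {E : Type*} [Fintype E] [DecidableEq E]
    (P : Matrix E E ℝ) (hP : P ∈ Matrix.rowStochastic ℝ E)
    (p : ReflectedWalk.Space d → E → ReflectedWalk.Step d → ℝ)
    (hp : ReflectedWalk.IsStepLaw p)
    (hSmooth : ReflectedWalk.SmoothLaw p)
    (hElliptic : ReflectedWalk.EllipticLaw p)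
    (hErgodic : P.IsIrreducible)
    (i : E) :
    (∀ (x α : ReflectedWalk.Space d) (j : E),
      Tendsto (ReflectedWalk.scaledCumulant P p j x α) atTop
        (𝓝 (ReflectedWalk.hamiltonian P p i x α))) ∧
    (∀ x ∈ ReflectedWalk.cube d, ReflectedWalk.quasiPotential P p i 0 x < ⊤) ∧
    (ContDiffOn ℝ 1 (ReflectedWalk.potential P p i) (ReflectedWalk.cube d \ {0}) →
    (∀ x ∈ ReflectedWalk.openCube d,
      ReflectedWalk.hamiltonian P p i x (gradient (ReflectedWalk.potential P p i) x) = 0) ∧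
    (∀ x ∈ frontier (ReflectedWalk.cube d) \ {0},
      ReflectedWalk.hamiltonian P p i x
        (ReflectedWalk.gradPlus (ReflectedWalk.potential P p i) x) = 0)) := by
  refine ⟨fun x α j => ReflectedWalk.tendsto_scaledCumulant hP hp hErgodic i j x α,
    fun x hx => ReflectedWalk.quasiPotential_lt_top hP hp hSmooth hElliptic hErgodic i hx,
    fun hV => ?_⟩
  have key : ∀ x ∈ ReflectedWalk.cube d \ {0}, ReflectedWalk.hamiltonian P p i x
      (ReflectedWalk.gradPlus (ReflectedWalk.potential P p i) x) = 0 := fun x hx =>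
    ReflectedWalk.hamiltonian_gradPlus_eq_zero hP hp hSmooth hElliptic hErgodic hx
      (hV.differentiableOn one_ne_zero x hx)
  -- The step probabilities sum to one, which forces `d ≥ 1`.
  obtain ⟨⟨l, -⟩⟩ : Nonempty (ReflectedWalk.Step d) := by
    by_contra h
    rw [not_nonempty_iff] at h
    simpa using hp.sum_eq_one 0 i
  refine ⟨fun x hx => ?_, fun x hx => key x ⟨ReflectedWalk.isClosed_cube.frontier_subset hx.1, hx.2⟩⟩
  rw [← ReflectedWalk.gradPlus_eq_gradient _ hx l]
  exact key x (ReflectedWalk.openCube_subset l hx)
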